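/- **Trivalent ribbon categories.** Let $\mathcal C$ be a $\mathbb C$-linear ribbon category, $X$ an object of $\mathcal C$ with a self-duality (a cap $X\otimes X\to\mathbf 1$ and a cup $\mathbf 1\to X\otimes X$ satisfying the zigzag identities), and $\tau:X\otimes X\to X$ a morphism, drawn as a trivalent vertex. Put $\mathcal C(n)=\mathrm{Hom}(X^{\otimes n},\mathbf 1)$. In the formulas below $\beta:X\otimes X\to X\otimes X$ is the braiding, $\mathrm{id}$ is the identity of $X\otimes X$ (two vertical strands), and $$S=(\mathrm{id}_X\otimes\tau)(\mathrm{cup}\otimes \mathrm{id}_X):X\to X\otimes X,\quad I=S\tau,\quad H=(\tau\otimes \mathrm{id}_X)(\mathrm{id}_X\otimes S),\quad E=\mathrm{cup}\circ\mathrm{cap},\quad P=\beta,\quad N=\beta^{-1}.$$ The square is $H^2$. We call $(\mathcal C,X,\tau)$ a *trivalent ribbon category over $\mathbb C$* if $\mathcal C(1)=0$; $\mathcal C(0)$, $\mathcal C(2)$, $\mathcal C(3)$ are one-dimensional, spanned by $\mathrm{id}_{\mathbf 1}$, $\mathrm{cap}$ and $\mathrm{cap}\circ(\tau\otimes\mathrm{id}_X)$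 respectively; every morphism between tensor powers of $X$ is obtained from $\tau$ by linear combinations, composition, tensor product and the ribbon structure (cups, caps, crossings, twists); and $\mathrm{cap}\circ\mathrm{cup}$ and $\tau S$ are nonzero multiples of $\mathrm{id}_{\mathbf 1}$ and $\mathrm{id}_X$. **Relations.** For $v\in\mathbb C^\times$ and $d,b,t\in\mathbb C$, the *elementary relations* are $$\mathrm{cap}\circ\mathrm{cup}=d,\quad \tau\circ\mathrm{cup}=0,\quad \tau S=b\,\mathrm{id}_X,\quad \tau H=t\,\tau,\quad \tau N=-v^6\tau,\quad N\circ\mathrm{cup}=v^{12}\,\mathrm{cup}.$$ For $\alpha\in\mathbb C$, we say that $(\mathcal C,X,\tau)$ satisfies (QEJac-$\alpha$), with parameters $v\ne0$ and $\alpha$, if the elementary relations hold for this $v$ and some $d,b,t\in\mathbb C$, and $$v^{-3}NH+vI-v^{-1}H+\alpha\,(N+v^4E+v^{-4}\,\mathrm{id})=0.$$ **The category $\mathsf{QExc}_{\mathbb C,v,w}$.** For $v,w\in\mathbb C^\times$ and $k,n\in\mathbb Z$ put $[k\lambda+n]=w^kv^n-w^{-k}v^{-n}$, $\{k\lambda+n\}=w^kv^n+w^{-k}v^{-n}$,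 $\Psi_1=v-v^{-1}$, $\Psi_2=v+v^{-1}$, $\Psi_3=v^2+1+v^{-2}$, $\Psi_4=v^2+v^{-2}$, $\Psi_6=v^2-1+v^{-2}$. If $[\lambda]$, $[\lambda-1]$, $\Psi_1$, $\Psi_6$ are nonzero, $\mathsf{QExc}_{\mathbb C,v,w}$ is the $\mathbb C$-linear ribbon category whose objects are finite rows of points, and whose morphisms are linear combinations of diagrams of framed braided trivalent graphs, composed by stacking and tensored by juxtaposition, modulo planar isotopy (including rotation of vertices), the second and third Reidemeister moves, sliding a vertex through a crossing, and the following relations: * the elementary relations with $$d=-\frac{\Psi_4[\lambda+5][\lambda-6]}{[\lambda][\lambda-1]},\quad b=\{\lambda+2\}\{\lambda-3\}\Psi_3,\quad t=\Psi_2\bigl(\Psi_2\{2\lambda-1\}+v^4-v^2-1-v^{-2}+v^{-4}\bigr);$$ * $v^{-3}NH+vI-v^{-1}H-\dfrac{[\lambda][\lambda-1]}{\Psi_1}\,(N+v^4E+v^{-4}\,\mathrm{id})=0$; * $H^2-\dfrac{\Psi_2\Psi_6^2[\lambda][\lambda-1]}{\Psi_1^2}N+\dfrac{x_1}{\Psi_1}I+\dfrac{x_2}{\Psi_1}H+\dfrac{x_3}{\Psi_1^2}\,\mathrm{id}+\dfrac{x_4}{\Psi_1^2}E=0$,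 where $$\begin{aligned} x_1&=w^{-2}(1-v^2-v^4)+(v^{-4}-2v^{-2}+3v^2)+w^2(v^{-2}-1-v^2),\\ x_2&=w^{-2}(v^{-2}+1-v^2)+(-3v^{-2}+2v^2-v^4)+w^2(v^{-4}+v^{-2}-1),\\ x_3&=w^{-4}(v^{-2}-1)+w^{-2}(-2v^{-4}-v^{-2}+2-v^4)+(v^{-6}+4v^{-4}-2v^{-2}-1+v^2+v^4)\\ &\quad+w^2(-2v^{-6}-v^{-4}+2v^{-2}-v^2)+w^4(v^{-6}-v^{-4}),\\ x_4&=w^{-4}(-v^4+v^6)+w^{-2}(-v^{-2}+2v^2-v^4-2v^6)+(v^{-4}+v^{-2}-1-2v^2+4v^4+v^6)\\ &\quad+w^2(-v^{-4}+2-v^2-2v^4)+w^4(-1+v^2); \end{aligned}$$ * $N-P+\dfrac{\Psi_1}{\Psi_6}(I-H)+\dfrac{\Psi_1[\lambda][\lambda-1]}{\Psi_6}(\mathrm{id}-E)=0$. **Corollary.** Let $(\mathcal C,X,\tau)$ be a trivalent ribbon category over $\mathbb C$ with $\dim\mathcal C(4)\le5$ which satisfies (QEJac-$\alpha$) with parameters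 $v\in\mathbb C^\times$ and $\alpha\in\mathbb C$, where $v^{10}\ne1$ and $v^{12}\ne1$. Then there is $w\in\mathbb C^\times$ such that $[\lambda]$, $[\lambda-1]$, $\Psi_1$, $\Psi_6$ are nonzero (so that $\mathsf{QExc}_{\mathbb C,v,w}$ is defined), together with an evaluation functor $\mathsf{QExc}_{\mathbb C,v,w}\to\mathcal C$, that is, a $\mathbb C$-linear ribbon functor (strong monoidal, preserving braiding and twist), which sends the strand to $X$ and the trivalent vertex to $\tau$. -/

import Mathlib

open CategoryTheory MonoidalCategory

universe v₁ u₁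

/-! ### Balanced and ribbon categories -/

/-- A balanced category: a braided monoidal category with a twist `θ_X : X ≅ X`, natural in `X`,
such that `θ_{X ⊗ Y} = β_{Y,X} ∘ β_{X,Y} ∘ (θ_X ⊗ θ_Y)`. -/
class BalancedCategory (C : Type u₁) [Category.{v₁} C] [MonoidalCategory C]
    [BraidedCategory C] where
  /-- The twist. -/
  twist : ∀ X : C, X ≅ X
  twist_naturality : ∀ {X Y : C} (f : X ⟶ Y), f ≫ (twist Y).hom = (twist X).hom ≫ f
  twist_tensor : ∀ X Y : C,
    (twist (X ⊗ Y)).hom =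
      ((twist X).hom ⊗ₘ (twist Y).hom) ≫ (β_ X Y).hom ≫ (β_ Y X).hom

/-- A ribbon category: a balanced category with duals, such that the twist of a dual is the dual of
the twist, stated as `(θ_X ⊗ id) ∘ coev = (id ⊗ θ_{X*}) ∘ coev`. -/
class RibbonCategory (C : Type u₁) [Category.{v₁} C] [MonoidalCategory C]
    [BraidedCategory C] [RightRigidCategory C] extends BalancedCategory C where
  twist_dual : ∀ X : C,
    η_ X Xᘁ ≫ (twist X).hom ▷ Xᘁ = η_ X Xᘁ ≫ X ◁ (twist Xᘁ).hom

namespace BalancedCategory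

variable {C : Type u₁} [Category.{v₁} C] [MonoidalCategory C] [BraidedCategory C]

theorem twist_unit [BalancedCategory C] : (twist (𝟙_ C)).hom = 𝟙 (𝟙_ C) := by
  have h := twist_tensor (𝟙_ C) (𝟙_ C)
  have h2 := twist_naturality (λ_ (𝟙_ C)).hom
  rw [h] at h2
  have h3 : (β_ (𝟙_ C) (𝟙_ C)).hom ≫ (β_ (𝟙_ C) (𝟙_ C)).hom = 𝟙 _ := by
    simp [unitors_inv_equal]
  rw [h3, Category.comp_id, MonoidalCategory.tensorHom_def, Category.assoc,
    leftUnitor_naturality, unitors_equal, rightUnitor_naturality_assoc] at h2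
  have h4 := (cancel_epi _).1 h2
  have h5 : (twist (𝟙_ C)).hom ≫ 𝟙 _ = (twist (𝟙_ C)).hom ≫ (twist (𝟙_ C)).hom := by
    rw [Category.comp_id]; exact h4
  exact ((cancel_epi _).1 h5).symm

open BraidedCategory

/-- Crossing the two outgoing legs of nested cups. -/
theorem coev_tensor_braiding {X Y X' Y' : C} [ExactPairing X X'] [ExactPairing Y Y'] :
    η_ (X ⊗ Y) (Y' ⊗ X') ≫ (β_ X Y).hom ▷ (Y' ⊗ X') =
      η_ (Y ⊗ X) (X' ⊗ Y') ≫ (Y ⊗ X) ◁ (β_ X' Y').hom := by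
  have e1 : X ◁ η_ Y Y' ≫ (α_ _ _ _).inv ≫ (β_ X Y).hom ▷ Y' =
      (ρ_ X).hom ≫ (λ_ X).inv ≫ η_ Y Y' ▷ X ≫ (α_ _ _ _).hom ≫ Y ◁ (β_ X Y').inv ≫
        (α_ _ _ _).inv := by
    have := braiding_naturality_right X (η_ Y Y')
    rw [braiding_tensor_right_hom] at this
    rw [braiding_tensorUnit_right] at this
    have h := congrArg (fun f => f ≫ (α_ Y Y' X).hom ≫ Y ◁ (β_ X Y').inv ≫ (α_ _ _ _).inv) this
    simpa using h
  have e2 : η_ X X' ▷ Y' ≫ (α_ _ _ _).hom ≫ X ◁ (β_ X' Y').hom =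
      (λ_ Y').hom ≫ (ρ_ Y').inv ≫ Y' ◁ η_ X X' ≫ (α_ _ _ _).inv ≫ (β_ X Y').inv ▷ X' ≫
        (α_ _ _ _).hom := by
    have := braiding_naturality_left (η_ X X') Y'
    rw [braiding_tensor_left_hom] at this
    rw [braiding_tensorUnit_left] at this
    have h := congrArg (fun f => f ≫ (α_ _ _ _).inv ≫ (β_ X Y').inv ▷ X' ≫ (α_ _ _ _).hom) this
    simpa using h
  calc _ = η_ X X' ⊗≫ (X ◁ η_ Y Y' ≫ (α_ _ _ _).inv ≫ (β_ X Y).hom ▷ Y') ▷ X' ⊗≫ 𝟙 _ := by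
        rw [ExactPairing.tensor_coevaluation]; monoidal
    _ = 𝟙 _ ⊗≫ (𝟙_ C ◁ η_ X X' ≫ η_ Y Y' ▷ (X ⊗ X')) ⊗≫ Y ◁ (β_ X Y').inv ▷ X' ⊗≫ 𝟙 _ := by
        rw [e1]; monoidal
    _ = 𝟙 _ ⊗≫ (η_ Y Y' ▷ 𝟙_ C ≫ (Y ⊗ Y') ◁ η_ X X') ⊗≫ Y ◁ (β_ X Y').inv ▷ X' ⊗≫ 𝟙 _ := by
        rw [whisker_exchange]
    _ = η_ Y Y' ⊗≫ Y ◁ (η_ X X' ▷ Y' ≫ (α_ _ _ _).hom ≫ X ◁ (β_ X' Y').hom) ⊗≫ 𝟙 _ := by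
        rw [e2]; monoidal
    _ = _ := by
        rw [ExactPairing.tensor_coevaluation]; monoidal

theorem twist_dual_tensor [BalancedCategory C] {X Y X' Y' : C} [ExactPairing X X']
    [ExactPairing Y Y']
    (hX : η_ X X' ≫ (twist X).hom ▷ X' = η_ X X' ≫ X ◁ (twist X').hom)
    (hY : η_ Y Y' ≫ (twist Y).hom ▷ Y' = η_ Y Y' ≫ Y ◁ (twist Y').hom) :
    η_ (X ⊗ Y) (Y' ⊗ X') ≫ (twist (X ⊗ Y)).hom ▷ (Y' ⊗ X') =
      η_ (X ⊗ Y) (Y' ⊗ X') ≫ (X ⊗ Y) ◁ (twist (Y' ⊗ X')).hom := by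
  have h1 : η_ (X ⊗ Y) (Y' ⊗ X') ≫ ((twist X).hom ⊗ₘ (twist Y).hom) ▷ (Y' ⊗ X') =
      η_ (X ⊗ Y) (Y' ⊗ X') ≫ (X ⊗ Y) ◁ ((twist Y').hom ⊗ₘ (twist X').hom) := by
    calc _ = η_ X X' ⊗≫ (X ◁ η_ Y Y' ≫ (twist X).hom ▷ (Y ⊗ Y')) ▷ X' ⊗≫
            (X ◁ (twist Y).hom ▷ Y') ▷ X' ⊗≫ 𝟙 ((X ⊗ Y) ⊗ Y' ⊗ X') := by
          rw [ExactPairing.tensor_coevaluation, MonoidalCategory.tensorHom_def]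
          monoidal
      _ = (η_ X X' ≫ (twist X).hom ▷ X') ⊗≫
          (X ◁ (η_ Y Y' ≫ (twist Y).hom ▷ Y')) ▷ X' ⊗≫ 𝟙 ((X ⊗ Y) ⊗ Y' ⊗ X') := by
          rw [whisker_exchange]
          monoidal
      _ = η_ X X' ⊗≫ X ◁ (twist X').hom ⊗≫ (X ◁ η_ Y Y') ▷ X' ⊗≫
            (X ⊗ Y) ◁ (twist Y').hom ▷ X' ⊗≫ 𝟙 ((X ⊗ Y) ⊗ Y' ⊗ X') := by
          rw [hX, hY]
          monoidal
      _ = η_ X X' ⊗≫ X ◁ (𝟙_ C ◁ (twist X').hom ≫ η_ Y Y' ▷ X') ⊗≫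
            (X ⊗ Y) ◁ (twist Y').hom ▷ X' ⊗≫ 𝟙 ((X ⊗ Y) ⊗ Y' ⊗ X') := by
          monoidal
      _ = _ := by
          rw [whisker_exchange, ExactPairing.tensor_coevaluation,
            MonoidalCategory.tensorHom_def']
          monoidal
  have h2 := coev_tensor_braiding (X := X) (Y := Y) (X' := X') (Y' := Y')
  have h3 := coev_tensor_braiding (X := Y) (Y := X) (X' := Y') (Y' := X')
  rw [twist_tensor, twist_tensor, comp_whiskerRight, comp_whiskerRight, reassoc_of% h1,
    whisker_exchange_assoc, whisker_exchange, reassoc_of% h2, whisker_exchange_assoc,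
    reassoc_of% h3]
  simp only [← MonoidalCategory.whiskerLeft_comp]
  rw [braiding_naturality_assoc, braiding_naturality]

end BalancedCategory

/-! ### Diagrams

Planar diagrams of framed unoriented trivalent graphs, in a rectangle, read from the bottom
(source) to the top (target). -/

namespace TriDiag

/-- A row of points on a line (with a bracketing). -/
inductive Pts : Type
  | unit : Pts
  | pt : Pts
  | tensor : Pts → Pts → Pts

open Pts

/-- Formal `ℂ`-linear combinations of diagrams with bottom `A` and top `B`, written as
composites (`comp f g` is `f` followed by `g`, i.e. `g` stacked on top of `f`) and
juxtapositions of elementary pieces: cup, cap, trivalent vertex, crossings of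
bundles of strands and full twists of bundles of strands. -/
inductive Diag : Pts → Pts → Type
  /-- vertical strands -/
  | strands (A : Pts) : Diag A A
  | comp {A B D : Pts} : Diag A B → Diag B D → Diag A D
  | tensor {A B A' B' : Pts} : Diag A B → Diag A' B' → Diag (A.tensor A') (B.tensor B')
  | assoc (A B D : Pts) : Diag ((A.tensor B).tensor D) (A.tensor (B.tensor D))
  | assocInv (A B D : Pts) : Diag (A.tensor (B.tensor D)) ((A.tensor B).tensor D)
  | lunit (A : Pts) : Diag (unit.tensor A) A
  | lunitInv (A : Pts) : Diag A (unit.tensor A)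
  | runit (A : Pts) : Diag (A.tensor unit) A
  | runitInv (A : Pts) : Diag A (A.tensor unit)
  /-- the positive crossing of two bundles of strands -/
  | braid (A B : Pts) : Diag (A.tensor B) (B.tensor A)
  /-- the negative crossing of two bundles of strands, inverse to `braid A B` -/
  | braidInv (A B : Pts) : Diag (B.tensor A) (A.tensor B)
  /-- the positive full twist of a bundle of strands -/
  | twist (A : Pts) : Diag A A
  | twistInv (A : Pts) : Diag A A
  | cup : Diag unit (pt.tensor pt)
  | cap : Diag (pt.tensor pt) unit
  /-- the trivalent vertex, with two legs down and one leg up -/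
  | vertex : Diag (pt.tensor pt) pt
  | zero (A B : Pts) : Diag A B
  | add {A B : Pts} : Diag A B → Diag A B → Diag A B
  | smul {A B : Pts} : ℂ → Diag A B → Diag A B

namespace Diag

instance (A B : Pts) : Zero (Diag A B) := ⟨zero A B⟩
instance (A B : Pts) : Add (Diag A B) := ⟨add⟩
instance (A B : Pts) : SMul ℂ (Diag A B) := ⟨smul⟩

/-- Two points. -/
abbrev pt2 : Pts := pt.tensor pt

/-- The vertex with one leg down and two legs up: the left leg of a cup stays, the right leg is
joined with the incoming strand. -/
def split : Diag pt pt2 :=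
  (lunitInv pt).comp <| (cup.tensor (strands pt)).comp <| (assoc pt pt pt).comp <|
    (strands pt).tensor vertex

/-- The diagram `I`: two strands merge into one vertical strand, which splits again. -/
def I : Diag pt2 pt2 := vertex.comp split

/-- The diagram `H`: two vertical strands joined by a horizontal rung. -/
def H : Diag pt2 pt2 :=
  ((strands pt).tensor split).comp <| (assocInv pt pt pt).comp <| vertex.tensor (strands pt)

/-- Two vertical strands. -/
def twoStrands : Diag pt2 pt2 := strands pt2

/-- A cap with a cup above it. -/
def capCup : Diag pt2 pt2 := cap.comp cup

/-- The negative crossing of two strands. -/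
def negX : Diag pt2 pt2 := braidInv pt pt

/-- The positive crossing of two strands. -/
def posX : Diag pt2 pt2 := braid pt pt

/-- The diagram `H` with two of its legs crossed by a negative crossing. -/
def crossedH : Diag pt2 pt2 := H.comp negX

/-- The square with four legs. -/
def square : Diag pt2 pt2 := H.comp H

/-- The circle. -/
def circle : Diag unit unit := cup.comp cap

/-- The lollipop: a loop attached to a strand. -/
def lollipop : Diag unit pt := cup.comp vertex

/-- The bigon with two legs. -/
def bigon : Diag pt pt := split.comp vertex

/-- The triangle with three legs. -/
def triangle : Diag pt2 pt := H.comp vertex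

/-- The trivalent vertex with two of its legs crossed by a negative crossing. -/
def twistedVertex : Diag pt2 pt := negX.comp vertex

/-- The cup with its ends crossed by a negative crossing. -/
def twistedCup : Diag unit pt2 := cup.comp negX

/-- The trivalent vertex rotated by one click, `x ⊗ y ↦ ∑ᵢ ⟨x, y · eᵢ⟩ eⁱ`. -/
def rotatedVertex : Diag pt2 pt :=
  (runitInv pt2).comp <| ((strands pt2).tensor cup).comp <| (assoc pt pt pt2).comp <|
    ((strands pt).tensor (assocInv pt pt pt)).comp <|
    ((strands pt).tensor (vertex.tensor (strands pt))).comp <|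
    (assocInv pt pt pt).comp <| (cap.tensor (strands pt)).comp <| lunit pt

/-- The left-hand side of the quantum exceptional Jacobi relation with parameters `v`, `α`. -/
noncomputable def qeJac (v α : ℂ) : Diag pt2 pt2 :=
  v ^ (-3 : ℤ) • crossedH + v • I + (-v⁻¹) • H +
    α • (negX + v ^ (4 : ℤ) • capCup + v ^ (-4 : ℤ) • twoStrands)

end Diag

/-! ### Interpretation of diagrams in a ribbon category -/

section Eval

variable {C : Type u₁} [Category.{v₁} C] [Preadditive C] [Linear ℂ C] [MonoidalCategory C]
  [BraidedCategory C] [BalancedCategory C]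

/-- The tensor power of `X` indexed by a row of points. -/
def Pts.eval (X : C) : Pts → C
  | unit => 𝟙_ C
  | pt => X
  | tensor A B => A.eval X ⊗ B.eval X

/-- The morphism given by a diagram, for a self-duality of `X` (the cup and the cap) and a
morphism `τ : X ⊗ X ⟶ X` (the trivalent vertex). -/
def Diag.eval (X : C) [ExactPairing X X] (τ : X ⊗ X ⟶ X) :
    {A B : Pts} → Diag A B → (A.eval X ⟶ B.eval X)
  | _, _, .strands A => 𝟙 (A.eval X)
  | _, _, .comp f g => f.eval X τ ≫ g.eval X τ
  | _, _, .tensor f g => f.eval X τ ⊗ₘ g.eval X τ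
  | _, _, .assoc A B D => (α_ (A.eval X) (B.eval X) (D.eval X)).hom
  | _, _, .assocInv A B D => (α_ (A.eval X) (B.eval X) (D.eval X)).inv
  | _, _, .lunit A => (λ_ (A.eval X)).hom
  | _, _, .lunitInv A => (λ_ (A.eval X)).inv
  | _, _, .runit A => (ρ_ (A.eval X)).hom
  | _, _, .runitInv A => (ρ_ (A.eval X)).inv
  | _, _, .braid A B => (β_ (A.eval X) (B.eval X)).hom
  | _, _, .braidInv A B => (β_ (A.eval X) (B.eval X)).inv
  | _, _, .twist A => (BalancedCategory.twist (A.eval X)).hom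
  | _, _, .twistInv A => (BalancedCategory.twist (A.eval X)).inv
  | _, _, .cup => η_ X X
  | _, _, .cap => ε_ X X
  | _, _, .vertex => τ
  | _, _, .zero A B => (0 : A.eval X ⟶ B.eval X)
  | _, _, .add f g => f.eval X τ + g.eval X τ
  | _, _, .smul c f => c • f.eval X τ

end Eval

/-! ### Trivalent ribbon categories -/

section Trivalent

variable {C : Type u₁} [Category.{v₁} C] [Preadditive C] [Linear ℂ C] [MonoidalCategory C]
  [BraidedCategory C] [BalancedCategory C]

/-- `x` generates the complex vector space `M` freely (so `M` has dimension one). -/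
def FreelyGenerates {M : Type*} [AddCommGroup M] [Module ℂ M] (x : M) : Prop :=
  Function.Bijective (fun c : ℂ => c • x)

/-- `(C, X, τ)` is a trivalent ribbon category over `ℂ`. The `n`-box space is
`Hom(X^{⊗ n}, 𝟙)`; the strand in the 2-box space is the cap of a self-duality of `X`, and `τ` is
seen in the 3-box space by turning its output down with that cap. -/
structure IsTrivalentRibbon (X : C) [ExactPairing X X] (τ : X ⊗ X ⟶ X) : Prop where
  box_zero : FreelyGenerates (𝟙 (𝟙_ C))
  box_one : ∀ f : X ⟶ 𝟙_ C, f = 0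
  box_two : FreelyGenerates (ε_ X X)
  box_three : FreelyGenerates (τ ▷ X ≫ ε_ X X)
  /-- Every morphism between tensor powers of `X` is a linear combination of diagrams built from
  `τ` by the ribbon structure. -/
  generated : ∀ A B : Pts, Function.Surjective (Diag.eval X τ : Diag A B → _)
  circle_ne_zero : ∃ d : ℂ, d ≠ 0 ∧ Diag.circle.eval X τ = d • 𝟙 (𝟙_ C)
  bigon_ne_zero : ∃ b : ℂ, b ≠ 0 ∧ Diag.bigon.eval X τ = b • 𝟙 X

/-- The elementary skein relations (circle, lollipop, bigon, triangle, twisted vertex, twisted cup)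
hold in `C`, with the given constants. -/
structure SatisfiesElementary (X : C) [ExactPairing X X] (τ : X ⊗ X ⟶ X) (v d b t : ℂ) : Prop where
  circle : Diag.circle.eval X τ = d • 𝟙 (𝟙_ C)
  lollipop : Diag.lollipop.eval X τ = 0
  bigon : Diag.bigon.eval X τ = b • 𝟙 X
  triangle : Diag.triangle.eval X τ = t • τ
  twisted_vertex : Diag.twistedVertex.eval X τ = (-v ^ 6) • τ
  twisted_cup : Diag.twistedCup.eval X τ = v ^ 12 • η_ X X

/-- The quantum exceptional Jacobi relation with parameters `v`, `α` holds in `C`; this includes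
the elementary skein relations for the same `v`. -/
structure SatisfiesQEJac (X : C) [ExactPairing X X] (τ : X ⊗ X ⟶ X) (v α : ℂ) : Prop where
  v_ne_zero : v ≠ 0
  elementary : ∃ d b t : ℂ, SatisfiesElementary X τ v d b t
  jacobi : (Diag.qeJac v α).eval X τ = 0

end Trivalent

/-! ### The quantum exceptional category -/

section Params

/-- `[k λ + n] = w ^ k v ^ n - w ^ (-k) v ^ (-n)`. -/
noncomputable def qsub (v w : ℂ) (k n : ℤ) : ℂ := w ^ k * v ^ n - w ^ (-k) * v ^ (-n)

/-- `{k λ + n} = w ^ k v ^ n + w ^ (-k) v ^ (-n)`. -/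
noncomputable def qadd (v w : ℂ) (k n : ℤ) : ℂ := w ^ k * v ^ n + w ^ (-k) * v ^ (-n)

/-- `Ψ₁ = v - v⁻¹`. -/
noncomputable def psi1 (v : ℂ) : ℂ := v - v⁻¹
/-- `Ψ₂ = v + v⁻¹`. -/
noncomputable def psi2 (v : ℂ) : ℂ := v + v⁻¹
/-- `Ψ₃ = v² + 1 + v⁻²`. -/
noncomputable def psi3 (v : ℂ) : ℂ := v ^ 2 + 1 + v ^ (-2 : ℤ)
/-- `Ψ₄ = v² + v⁻²`. -/
noncomputable def psi4 (v : ℂ) : ℂ := v ^ 2 + v ^ (-2 : ℤ)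
/-- `Ψ₆ = v² - 1 + v⁻²`. -/
noncomputable def psi6 (v : ℂ) : ℂ := v ^ 2 - 1 + v ^ (-2 : ℤ)

/-- The elements of the ground field that have to be invertible for the quantum exceptional
category with parameters `v`, `w` to be defined. -/
structure Admissible (v w : ℂ) : Prop where
  v_ne_zero : v ≠ 0
  w_ne_zero : w ≠ 0
  lam_ne_zero : qsub v w 1 0 ≠ 0
  lam_sub_one_ne_zero : qsub v w 1 (-1) ≠ 0
  psi1_ne_zero : psi1 v ≠ 0
  psi6_ne_zero : psi6 v ≠ 0

/-- The value of the circle. -/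
noncomputable def circleVal (v w : ℂ) : ℂ :=
  -(psi4 v * qsub v w 1 5 * qsub v w 1 (-6) / (qsub v w 1 0 * qsub v w 1 (-1)))

/-- The value of the bigon. -/
noncomputable def bigonVal (v w : ℂ) : ℂ := qadd v w 1 2 * qadd v w 1 (-3) * psi3 v

/-- The value of the triangle. -/
noncomputable def triangleVal (v w : ℂ) : ℂ :=
  psi2 v * (psi2 v * qadd v w 2 (-1) +
    (v ^ 4 - v ^ 2 - 1 - v ^ (-2 : ℤ) + v ^ (-4 : ℤ)))

/-- Coefficient in the square relation. -/
noncomputable def sqI (v w : ℂ) : ℂ :=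
  w ^ (-2 : ℤ) * (1 - v ^ 2 - v ^ 4) + (v ^ (-4 : ℤ) - 2 * v ^ (-2 : ℤ) + 3 * v ^ 2) +
    w ^ 2 * (v ^ (-2 : ℤ) - 1 - v ^ 2)

/-- Coefficient in the square relation. -/
noncomputable def sqH (v w : ℂ) : ℂ :=
  w ^ (-2 : ℤ) * (v ^ (-2 : ℤ) + 1 - v ^ 2) + (-3 * v ^ (-2 : ℤ) + 2 * v ^ 2 - v ^ 4) +
    w ^ 2 * (v ^ (-4 : ℤ) + v ^ (-2 : ℤ) - 1)

/-- Coefficient in the square relation. -/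
noncomputable def sqTwoStrands (v w : ℂ) : ℂ :=
  w ^ (-4 : ℤ) * (v ^ (-2 : ℤ) - 1) +
    w ^ (-2 : ℤ) * (-2 * v ^ (-4 : ℤ) - v ^ (-2 : ℤ) + 2 - v ^ 4) +
    (v ^ (-6 : ℤ) + 4 * v ^ (-4 : ℤ) - 2 * v ^ (-2 : ℤ) - 1 + v ^ 2 + v ^ 4) +
    w ^ 2 * (-2 * v ^ (-6 : ℤ) - v ^ (-4 : ℤ) + 2 * v ^ (-2 : ℤ) - v ^ 2) +
    w ^ 4 * (v ^ (-6 : ℤ) - v ^ (-4 : ℤ))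

/-- Coefficient in the square relation. -/
noncomputable def sqCapCup (v w : ℂ) : ℂ :=
  w ^ (-4 : ℤ) * (-v ^ 4 + v ^ 6) +
    w ^ (-2 : ℤ) * (-v ^ (-2 : ℤ) + 2 * v ^ 2 - v ^ 4 - 2 * v ^ 6) +
    (v ^ (-4 : ℤ) + v ^ (-2 : ℤ) - 1 - 2 * v ^ 2 + 4 * v ^ 4 + v ^ 6) +
    w ^ 2 * (-v ^ (-4 : ℤ) + 2 - v ^ 2 - 2 * v ^ 4) +
    w ^ 4 * (-1 + v ^ 2)

/-- `[λ][λ-1]`. -/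
noncomputable def lamProd (v w : ℂ) : ℂ := qsub v w 1 0 * qsub v w 1 (-1)

open Diag

/-- The left-hand side of the quantum exceptional square relation. -/
noncomputable def qeSq (v w : ℂ) : Diag pt2 pt2 :=
  square + (-psi2 v * psi6 v ^ 2 * lamProd v w / psi1 v ^ 2) • negX +
    (sqI v w / psi1 v) • I + (sqH v w / psi1 v) • H +
    (sqCapCup v w / psi1 v ^ 2) • capCup + (sqTwoStrands v w / psi1 v ^ 2) • twoStrands

/-- The left-hand side of the quantum exceptional crossing relation. -/
noncomputable def qeCross (v w : ℂ) : Diag pt2 pt2 :=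
  negX + (-1 : ℂ) • posX + (psi1 v / psi6 v) • (I + (-1 : ℂ) • H) +
    (psi1 v * lamProd v w / psi6 v) • (twoStrands + (-1 : ℂ) • capCup)

/-- The defining skein relations of the quantum exceptional category. -/
inductive Skein (v w : ℂ) : {A B : Pts} → Diag A B → Diag A B → Prop
  | circle : Skein v w circle (circleVal v w • strands unit)
  | lollipop : Skein v w lollipop 0
  | bigon : Skein v w bigon (bigonVal v w • strands pt)
  | triangle : Skein v w triangle (triangleVal v w • vertex)
  | twisted_vertex : Skein v w twistedVertex ((-v ^ 6) • vertex)
  | twisted_cup : Skein v w twistedCup (v ^ 12 • cup)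
  | jacobi : Skein v w (qeJac v (-(lamProd v w / psi1 v))) 0
  | square : Skein v w (qeSq v w) 0
  | crossing : Skein v w (qeCross v w) 0

/-- Equality of linear combinations of diagrams in the quantum exceptional category: the smallest
congruence that contains the laws of a `ℂ`-linear strong monoidal category, the isotopies of
framed trivalent graph diagrams, and the skein relations. -/
inductive Rel (v w : ℂ) : {A B : Pts} → Diag A B → Diag A B → Prop
  -- equivalence relation
  | refl {A B} (f : Diag A B) : Rel v w f f
  | symm {A B} {f g : Diag A B} : Rel v w f g → Rel v w g f
  | trans {A B} {f g h : Diag A B} : Rel v w f g → Rel v w g h → Rel v w f h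
  -- congruence
  | comp_congr {A B D} {f f' : Diag A B} {g g' : Diag B D} :
      Rel v w f f' → Rel v w g g' → Rel v w (f.comp g) (f'.comp g')
  | tensor_congr {A B A' B'} {f f' : Diag A B} {g g' : Diag A' B'} :
      Rel v w f f' → Rel v w g g' → Rel v w (f.tensor g) (f'.tensor g')
  | add_congr {A B} {f f' g g' : Diag A B} :
      Rel v w f f' → Rel v w g g' → Rel v w (f + g) (f' + g')
  | smul_congr {A B} (c : ℂ) {f f' : Diag A B} : Rel v w f f' → Rel v w (c • f) (c • f')
  -- vector space laws
  | add_assoc {A B} (f g h : Diag A B) : Rel v w (f + g + h) (f + (g + h))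
  | add_comm {A B} (f g : Diag A B) : Rel v w (f + g) (g + f)
  | zero_add {A B} (f : Diag A B) : Rel v w (0 + f) f
  | zero_smul {A B} (f : Diag A B) : Rel v w ((0 : ℂ) • f) 0
  | one_smul {A B} (f : Diag A B) : Rel v w ((1 : ℂ) • f) f
  | mul_smul {A B} (c e : ℂ) (f : Diag A B) : Rel v w ((c * e) • f) (c • e • f)
  | smul_add {A B} (c : ℂ) (f g : Diag A B) : Rel v w (c • (f + g)) (c • f + c • g)
  | add_smul {A B} (c e : ℂ) (f : Diag A B) : Rel v w ((c + e) • f) (c • f + e • f)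
  -- bilinearity of composition and juxtaposition
  | add_comp {A B D} (f f' : Diag A B) (g : Diag B D) :
      Rel v w ((f + f').comp g) (f.comp g + f'.comp g)
  | comp_add {A B D} (f : Diag A B) (g g' : Diag B D) :
      Rel v w (f.comp (g + g')) (f.comp g + f.comp g')
  | smul_comp {A B D} (c : ℂ) (f : Diag A B) (g : Diag B D) :
      Rel v w ((c • f).comp g) (c • f.comp g)
  | comp_smul {A B D} (c : ℂ) (f : Diag A B) (g : Diag B D) :
      Rel v w (f.comp (c • g)) (c • f.comp g)
  | add_tensor {A B A' B'} (f f' : Diag A B) (g : Diag A' B') :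
      Rel v w ((f + f').tensor g) (f.tensor g + f'.tensor g)
  | tensor_add {A B A' B'} (f : Diag A B) (g g' : Diag A' B') :
      Rel v w (f.tensor (g + g')) (f.tensor g + f.tensor g')
  | smul_tensor {A B A' B'} (c : ℂ) (f : Diag A B) (g : Diag A' B') :
      Rel v w ((c • f).tensor g) (c • f.tensor g)
  | tensor_smul {A B A' B'} (c : ℂ) (f : Diag A B) (g : Diag A' B') :
      Rel v w (f.tensor (c • g)) (c • f.tensor g)
  -- category laws
  | id_comp {A B} (f : Diag A B) : Rel v w ((strands A).comp f) f
  | comp_id {A B} (f : Diag A B) : Rel v w (f.comp (strands B)) f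
  | comp_assoc {A B D E} (f : Diag A B) (g : Diag B D) (h : Diag D E) :
      Rel v w ((f.comp g).comp h) (f.comp (g.comp h))
  -- monoidal laws (distant pieces can be moved past each other)
  | tensor_id (A B) : Rel v w ((strands A).tensor (strands B)) (strands (A.tensor B))
  | tensor_comp {A B D A' B' D'} (f : Diag A B) (g : Diag A' B') (h : Diag B D)
      (k : Diag B' D') :
      Rel v w ((f.tensor g).comp (h.tensor k)) ((f.comp h).tensor (g.comp k))
  | assoc_hom_inv (A B D) : Rel v w ((assoc A B D).comp (assocInv A B D)) (strands _)
  | assoc_inv_hom (A B D) : Rel v w ((assocInv A B D).comp (assoc A B D)) (strands _)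
  | assoc_naturality {A B D A' B' D'} (f : Diag A A') (g : Diag B B') (h : Diag D D') :
      Rel v w (((f.tensor g).tensor h).comp (assoc A' B' D'))
        ((assoc A B D).comp (f.tensor (g.tensor h)))
  | lunit_hom_inv (A) : Rel v w ((lunit A).comp (lunitInv A)) (strands _)
  | lunit_inv_hom (A) : Rel v w ((lunitInv A).comp (lunit A)) (strands _)
  | lunit_naturality {A B} (f : Diag A B) :
      Rel v w (((strands unit).tensor f).comp (lunit B)) ((lunit A).comp f)
  | runit_hom_inv (A) : Rel v w ((runit A).comp (runitInv A)) (strands _)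
  | runit_inv_hom (A) : Rel v w ((runitInv A).comp (runit A)) (strands _)
  | runit_naturality {A B} (f : Diag A B) :
      Rel v w ((f.tensor (strands unit)).comp (runit B)) ((runit A).comp f)
  | pentagon (A B D E) :
      Rel v w (((assoc A B D).tensor (strands E)).comp
          ((assoc A (B.tensor D) E).comp ((strands A).tensor (assoc B D E))))
        ((assoc (A.tensor B) D E).comp (assoc A B (D.tensor E)))
  | triangle (A B) :
      Rel v w ((assoc A unit B).comp ((strands A).tensor (lunit B))) ((runit A).tensor (strands B))
  -- crossings: second and third Reidemeister moves, and sliding any diagram (in particular a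
  -- trivalent vertex, a cup or a cap) through a crossing
  | braid_hom_inv (A B) : Rel v w ((braid A B).comp (braidInv A B)) (strands _)
  | braid_inv_hom (A B) : Rel v w ((braidInv A B).comp (braid A B)) (strands _)
  | braid_naturality {A B A' B'} (f : Diag A A') (g : Diag B B') :
      Rel v w ((f.tensor g).comp (braid A' B')) ((braid A B).comp (g.tensor f))
  | hexagon_forward (A B D) :
      Rel v w ((assoc A B D).comp ((braid A (B.tensor D)).comp (assoc B D A)))
        (((braid A B).tensor (strands D)).comp ((assoc B A D).comp ((strands B).tensor (braid A D))))
  | hexagon_reverse (A B D) :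
      Rel v w ((assocInv A B D).comp ((braid (A.tensor B) D).comp (assocInv D A B)))
        (((strands A).tensor (braid B D)).comp ((assocInv A D B).comp ((braid A D).tensor (strands B))))
  -- full twists: they slide through any diagram, the full twist of two bundles is the full twist
  -- of each of them and a full turn around each other, and the full twist of one strand is a curl
  | twist_hom_inv (A) : Rel v w ((twist A).comp (twistInv A)) (strands _)
  | twist_inv_hom (A) : Rel v w ((twistInv A).comp (twist A)) (strands _)
  | twist_naturality {A B} (f : Diag A B) : Rel v w (f.comp (twist B)) ((twist A).comp f)
  | twist_tensor (A B) :
      Rel v w (twist (A.tensor B))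
        (((twist A).tensor (twist B)).comp ((braid A B).comp (braid B A)))
  | twist_curl : Rel v w (cup.comp ((twist pt).tensor (strands pt))) twistedCup
  -- planar isotopy: straightening a strand, rotating a trivalent vertex
  | zigzag_left :
      Rel v w (((strands pt).tensor cup).comp ((assocInv pt pt pt).comp (cap.tensor (strands pt))))
        ((runit pt).comp (lunitInv pt))
  | zigzag_right :
      Rel v w ((cup.tensor (strands pt)).comp ((assoc pt pt pt).comp ((strands pt).tensor cap)))
        ((lunit pt).comp (runitInv pt))
  | rotate : Rel v w rotatedVertex vertex
  -- skein relations
  | skein {A B} {f g : Diag A B} : Skein v w f g → Rel v w f g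

end Params

/-! ### The quantum exceptional category as a ribbon category -/

section Category

/-- The objects of the quantum exceptional category with parameters `v`, `w`: rows of points. -/
structure QExc (v w : ℂ) : Type where
  /-- The row of points. -/
  pts : Pts

namespace QExc

variable {v w : ℂ}

/-- Diagrams up to equality in the quantum exceptional category. -/
def relSetoid (v w : ℂ) (A B : Pts) : Setoid (Diag A B) where
  r := Rel v w
  iseqv := ⟨Rel.refl, Rel.symm, Rel.trans⟩

instance : CategoryStruct (QExc v w) where
  Hom A B := Quotient (relSetoid v w A.pts B.pts)
  id A := Quotient.mk _ (.strands A.pts)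
  comp := Quotient.map₂ Diag.comp fun _ _ h _ _ k => Rel.comp_congr h k

/-- The morphism represented by a linear combination of diagrams. -/
def ofDiag {A B : QExc v w} (f : Diag A.pts B.pts) : A ⟶ B := Quotient.mk (relSetoid v w _ _) f

theorem sound {A B : QExc v w} {f g : Diag A.pts B.pts} (h : Rel v w f g) :
    (ofDiag f : A ⟶ B) = ofDiag g := Quotient.sound h

instance : Category (QExc v w) where
  id_comp := by rintro _ _ ⟨f⟩; exact sound (.id_comp f)
  comp_id := by rintro _ _ ⟨f⟩; exact sound (.comp_id f)
  assoc := by rintro _ _ _ _ ⟨f⟩ ⟨g⟩ ⟨h⟩; exact sound (.comp_assoc f g h)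

instance (A B : QExc v w) : Zero (A ⟶ B) := ⟨ofDiag 0⟩
instance (A B : QExc v w) : Add (A ⟶ B) :=
  ⟨Quotient.map₂ (· + ·) fun _ _ h _ _ k => Rel.add_congr h k⟩
instance (A B : QExc v w) : SMul ℂ (A ⟶ B) :=
  ⟨fun c => Quotient.map (c • ·) fun _ _ h => Rel.smul_congr c h⟩
instance (A B : QExc v w) : Neg (A ⟶ B) := ⟨fun f => (-1 : ℂ) • f⟩

theorem hom_zero_add {A B : QExc v w} (f : A ⟶ B) : 0 + f = f := by
  obtain ⟨f⟩ := f; exact sound (.zero_add f)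
theorem hom_add_comm {A B : QExc v w} (f g : A ⟶ B) : f + g = g + f := by
  obtain ⟨f⟩ := f; obtain ⟨g⟩ := g; exact sound (.add_comm f g)
theorem hom_zero_smul {A B : QExc v w} (f : A ⟶ B) : (0 : ℂ) • f = 0 := by
  obtain ⟨f⟩ := f; exact sound (.zero_smul f)
theorem hom_one_smul {A B : QExc v w} (f : A ⟶ B) : (1 : ℂ) • f = f := by
  obtain ⟨f⟩ := f; exact sound (.one_smul f)
theorem hom_mul_smul {A B : QExc v w} (c e : ℂ) (f : A ⟶ B) : (c * e) • f = c • e • f := by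
  obtain ⟨f⟩ := f; exact sound (.mul_smul c e f)
theorem hom_add_smul {A B : QExc v w} (c e : ℂ) (f : A ⟶ B) : (c + e) • f = c • f + e • f := by
  obtain ⟨f⟩ := f; exact sound (.add_smul c e f)
theorem hom_smul_add {A B : QExc v w} (c : ℂ) (f g : A ⟶ B) : c • (f + g) = c • f + c • g := by
  obtain ⟨f⟩ := f; obtain ⟨g⟩ := g; exact sound (.smul_add c f g)

instance (A B : QExc v w) : AddCommGroup (A ⟶ B) where
  add_assoc := by rintro ⟨f⟩ ⟨g⟩ ⟨h⟩; exact sound (.add_assoc f g h)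
  zero_add := hom_zero_add
  add_zero f := by rw [hom_add_comm, hom_zero_add]
  add_comm := hom_add_comm
  neg_add_cancel f := by
    change (-1 : ℂ) • f + f = 0
    nth_rewrite 2 [← hom_one_smul f]
    rw [← hom_add_smul, neg_add_cancel, hom_zero_smul]
  nsmul := nsmulRec
  zsmul := zsmulRec

instance (A B : QExc v w) : Module ℂ (A ⟶ B) where
  one_smul := hom_one_smul
  mul_smul := hom_mul_smul
  smul_zero c := by
    rw [← hom_zero_smul (0 : A ⟶ B), ← hom_mul_smul, mul_zero]
  smul_add := hom_smul_add
  add_smul := hom_add_smul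
  zero_smul := hom_zero_smul

instance : Preadditive (QExc v w) where
  add_comp := by rintro _ _ _ ⟨f⟩ ⟨f'⟩ ⟨g⟩; exact sound (.add_comp f f' g)
  comp_add := by rintro _ _ _ ⟨f⟩ ⟨g⟩ ⟨g'⟩; exact sound (.comp_add f g g')

instance : Linear ℂ (QExc v w) where
  smul_comp := by rintro _ _ _ c ⟨f⟩ ⟨g⟩; exact sound (.smul_comp c f g)
  comp_smul := by rintro _ _ _ ⟨f⟩ c ⟨g⟩; exact sound (.comp_smul c f g)

/-- Juxtaposition of morphisms. -/
def tensorHom' {A B A' B' : QExc v w} (f : A ⟶ B) (g : A' ⟶ B') :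
    (⟨A.pts.tensor A'.pts⟩ : QExc v w) ⟶ ⟨B.pts.tensor B'.pts⟩ :=
  Quotient.map₂ Diag.tensor (fun _ _ h _ _ k => Rel.tensor_congr h k) f g

instance : MonoidalCategoryStruct (QExc v w) where
  tensorObj A B := ⟨A.pts.tensor B.pts⟩
  tensorUnit := ⟨.unit⟩
  tensorHom f g := tensorHom' f g
  whiskerLeft A _ _ f := tensorHom' (𝟙 A) f
  whiskerRight f A := tensorHom' f (𝟙 A)
  associator A B D :=
    { hom := ofDiag (.assoc A.pts B.pts D.pts)
      inv := ofDiag (.assocInv A.pts B.pts D.pts)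
      hom_inv_id := sound (.assoc_hom_inv _ _ _)
      inv_hom_id := sound (.assoc_inv_hom _ _ _) }
  leftUnitor A :=
    { hom := ofDiag (.lunit A.pts)
      inv := ofDiag (.lunitInv A.pts)
      hom_inv_id := sound (.lunit_hom_inv _)
      inv_hom_id := sound (.lunit_inv_hom _) }
  rightUnitor A :=
    { hom := ofDiag (.runit A.pts)
      inv := ofDiag (.runitInv A.pts)
      hom_inv_id := sound (.runit_hom_inv _)
      inv_hom_id := sound (.runit_inv_hom _) }

instance : MonoidalCategory (QExc v w) :=
  MonoidalCategory.ofTensorHom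
    (id_tensorHom_id := fun A B => sound (.tensor_id A.pts B.pts))
    (id_tensorHom := fun _ _ _ _ => rfl)
    (tensorHom_id := fun _ _ => rfl)
    (tensorHom_comp_tensorHom := by
      rintro _ _ _ _ _ _ ⟨f⟩ ⟨g⟩ ⟨h⟩ ⟨k⟩; exact sound (.tensor_comp f g h k))
    (associator_naturality := by
      rintro _ _ _ _ _ _ ⟨f⟩ ⟨g⟩ ⟨h⟩; exact sound (.assoc_naturality f g h))
    (leftUnitor_naturality := by rintro _ _ ⟨f⟩; exact sound (.lunit_naturality f))
    (rightUnitor_naturality := by rintro _ _ ⟨f⟩; exact sound (.runit_naturality f))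
    (pentagon := fun A B D E => sound (.pentagon A.pts B.pts D.pts E.pts))
    (triangle := fun A B => sound (.triangle A.pts B.pts))

theorem hom_add_tensor {A B A' B' : QExc v w} (f f' : A ⟶ B) (g : A' ⟶ B') :
    tensorHom' (f + f') g = tensorHom' f g + tensorHom' f' g := by
  obtain ⟨f⟩ := f; obtain ⟨f'⟩ := f'; obtain ⟨g⟩ := g; exact sound (.add_tensor f f' g)
theorem hom_tensor_add {A B A' B' : QExc v w} (f : A ⟶ B) (g g' : A' ⟶ B') :
    tensorHom' f (g + g') = tensorHom' f g + tensorHom' f g' := by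
  obtain ⟨f⟩ := f; obtain ⟨g⟩ := g; obtain ⟨g'⟩ := g'; exact sound (.tensor_add f g g')
theorem hom_smul_tensor {A B A' B' : QExc v w} (c : ℂ) (f : A ⟶ B) (g : A' ⟶ B') :
    tensorHom' (c • f) g = c • tensorHom' f g := by
  obtain ⟨f⟩ := f; obtain ⟨g⟩ := g; exact sound (.smul_tensor c f g)
theorem hom_tensor_smul {A B A' B' : QExc v w} (c : ℂ) (f : A ⟶ B) (g : A' ⟶ B') :
    tensorHom' f (c • g) = c • tensorHom' f g := by
  obtain ⟨f⟩ := f; obtain ⟨g⟩ := g; exact sound (.tensor_smul c f g)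

instance : MonoidalPreadditive (QExc v w) where
  whiskerLeft_zero {X Y Z} := by
    change tensorHom' (𝟙 X) (0 : Y ⟶ Z) = 0
    rw [← hom_zero_smul (0 : Y ⟶ Z), hom_tensor_smul]
    exact hom_zero_smul (A := X ⊗ Y) (B := X ⊗ Z) _
  zero_whiskerRight {X Y Z} := by
    change tensorHom' (0 : Y ⟶ Z) (𝟙 X) = 0
    rw [← hom_zero_smul (0 : Y ⟶ Z), hom_smul_tensor]
    exact hom_zero_smul (A := Y ⊗ X) (B := Z ⊗ X) _
  whiskerLeft_add _ _ := hom_tensor_add _ _ _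
  add_whiskerRight _ _ := hom_add_tensor _ _ _

instance : MonoidalLinear ℂ (QExc v w) where
  whiskerLeft_smul _ _ _ _ _ := hom_tensor_smul _ _ _
  smul_whiskerRight _ _ _ _ _ := hom_smul_tensor _ _ _

instance : BraidedCategory (QExc v w) where
  braiding A B :=
    { hom := ofDiag (.braid A.pts B.pts)
      inv := ofDiag (.braidInv A.pts B.pts)
      hom_inv_id := sound (.braid_hom_inv _ _)
      inv_hom_id := sound (.braid_inv_hom _ _) }
  braiding_naturality_right := by
    rintro A _ _ ⟨f⟩; exact sound (.braid_naturality (.strands A.pts) f)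
  braiding_naturality_left := by
    rintro _ _ ⟨f⟩ A; exact sound (.braid_naturality f (.strands A.pts))
  hexagon_forward A B D := sound (.hexagon_forward A.pts B.pts D.pts)
  hexagon_reverse A B D := sound (.hexagon_reverse A.pts B.pts D.pts)

instance : BalancedCategory (QExc v w) where
  twist A :=
    { hom := ofDiag (.twist A.pts)
      inv := ofDiag (.twistInv A.pts)
      hom_inv_id := sound (.twist_hom_inv _)
      inv_hom_id := sound (.twist_inv_hom _) }
  twist_naturality := by rintro _ _ ⟨f⟩; exact sound (.twist_naturality f)
  twist_tensor A B := sound (.twist_tensor A.pts B.pts)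

/-- The object given by one point. -/
abbrev strand (v w : ℂ) : QExc v w := ⟨.pt⟩

/-- The generating trivalent vertex. -/
def vertex (v w : ℂ) : strand v w ⊗ strand v w ⟶ strand v w :=
  ofDiag (A := strand v w ⊗ strand v w) Diag.vertex

/-- The strand is self-dual by the cup and the cap. -/
instance : ExactPairing (strand v w) (strand v w) where
  coevaluation' := ofDiag (A := 𝟙_ (QExc v w)) (B := strand v w ⊗ strand v w) .cup
  evaluation' := ofDiag (A := strand v w ⊗ strand v w) (B := 𝟙_ (QExc v w)) .cap
  coevaluation_evaluation' := sound .zigzag_left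
  evaluation_coevaluation' := sound .zigzag_right

/-- The dual of a row of points is the reversed row. -/
def dual : Pts → Pts
  | .unit => .unit
  | .pt => .pt
  | .tensor A B => (dual B).tensor (dual A)

/-- The duality of a row of points, by nested cups and caps. -/
@[reducible]
def pairing {v w : ℂ} : (A : Pts) → ExactPairing (⟨A⟩ : QExc v w) ⟨dual A⟩
  | .unit => exactPairingUnit
  | .pt => inferInstanceAs (ExactPairing (strand v w) (strand v w))
  | .tensor A B =>
    letI : ExactPairing (⟨A⟩ : QExc v w) ⟨dual A⟩ := pairing A
    letI : ExactPairing (⟨B⟩ : QExc v w) ⟨dual B⟩ := pairing B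
    ExactPairing.tensor (C := QExc v w) (X₁ := ⟨A⟩) (X₂ := ⟨B⟩) (Y₁ := ⟨dual A⟩) (Y₂ := ⟨dual B⟩)

instance : RightRigidCategory (QExc v w) where
  rightDual A := { rightDual := ⟨dual A.pts⟩, exact := pairing A.pts }

theorem eq_smul_id_of_coev {X X' : QExc v w} [ExactPairing X X'] (c : ℂ) (f : X ⟶ X)
    (h : η_ X X' ≫ f ▷ X' = c • η_ X X') : f = c • 𝟙 X := by
  have h1 : (η_ X X' ≫ f ▷ X') ▷ X ≫ (α_ X X' X).hom ≫ X ◁ ε_ X X' =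
      (λ_ X).hom ≫ f ≫ (ρ_ X).inv := by
    rw [comp_whiskerRight, Category.assoc, associator_naturality_left_assoc,
      ← whisker_exchange, ExactPairing.evaluation_coevaluation_assoc]
    simp
  rw [h, MonoidalLinear.smul_whiskerRight, Linear.smul_comp,
    ExactPairing.evaluation_coevaluation, ← Linear.comp_smul] at h1
  have h2 := (cancel_epi _).1 h1
  rw [← cancel_mono (ρ_ X).inv, ← h2]
  simp

theorem twist_strand : (BalancedCategory.twist (strand v w)).hom = v ^ 12 • 𝟙 (strand v w) :=
  eq_smul_id_of_coev (X' := strand v w) _ _ (sound (A := 𝟙_ (QExc v w)) (B := strand v w ⊗ strand v w)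
    (Rel.trans .twist_curl (.skein .twisted_cup)))

theorem twist_dual_pts : ∀ A : Pts,
    (pairing (v := v) (w := w) A).coevaluation' ≫
        (BalancedCategory.twist (⟨A⟩ : QExc v w)).hom ▷ (⟨dual A⟩ : QExc v w) =
      (pairing (v := v) (w := w) A).coevaluation' ≫
        (⟨A⟩ : QExc v w) ◁ (BalancedCategory.twist (⟨dual A⟩ : QExc v w)).hom
  | .unit => by
    have h := BalancedCategory.twist_unit (C := QExc v w)
    change _ ≫ (BalancedCategory.twist (𝟙_ (QExc v w))).hom ▷ 𝟙_ (QExc v w) =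
      _ ≫ 𝟙_ (QExc v w) ◁ (BalancedCategory.twist (𝟙_ (QExc v w))).hom
    rw [h]; simp
  | .pt => by
    change _ ≫ (BalancedCategory.twist (strand v w)).hom ▷ strand v w =
      _ ≫ strand v w ◁ (BalancedCategory.twist (strand v w)).hom
    rw [twist_strand]; simp
  | .tensor A B =>
    letI : ExactPairing (⟨A⟩ : QExc v w) ⟨dual A⟩ := pairing A
    letI : ExactPairing (⟨B⟩ : QExc v w) ⟨dual B⟩ := pairing B
    BalancedCategory.twist_dual_tensor (X := (⟨A⟩ : QExc v w)) (Y := ⟨B⟩) (X' := ⟨dual A⟩)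
      (Y' := ⟨dual B⟩) (twist_dual_pts A) (twist_dual_pts B)

instance : RibbonCategory (QExc v w) where
  twist_dual A := twist_dual_pts A.pts

end QExc

end Category

/-! ### Evaluation functors -/

section Evaluation

open Functor.LaxMonoidal

variable {C : Type u₁} [Category.{v₁} C] [Preadditive C] [Linear ℂ C] [MonoidalCategory C]
  [BraidedCategory C] [BalancedCategory C]

/-- An evaluation functor from the quantum exceptional category with parameters `v`, `w` to `C`
that sends the strand to `X` and the trivalent vertex to `τ`: a `ℂ`-linear ribbon functor (that is,
a strong monoidal functor which preserves the braiding and the twist), together with an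
identification of the image of the strand with `X`, under which the image of the generating
trivalent vertex is `τ`. -/
structure EvaluationFunctor (v w : ℂ) (X : C) (τ : X ⊗ X ⟶ X) where
  functor : QExc v w ⥤ C
  [additive : functor.Additive]
  [linear : functor.Linear ℂ]
  [braided : functor.Braided]
  map_twist : ∀ A : QExc v w,
    functor.map (BalancedCategory.twist A).hom = (BalancedCategory.twist (functor.obj A)).hom
  strandIso : functor.obj (QExc.strand v w) ≅ X
  map_vertex :
    μ functor (QExc.strand v w) (QExc.strand v w) ≫ functor.map (QExc.vertex v w) ≫
      strandIso.hom = (strandIso.hom ⊗ₘ strandIso.hom) ≫ τ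

end Evaluation

end TriDiag

/-! Bending strands down embeds End(X ⊗ X) into C(4), so dim C(4) ≤ 5 forces a linear relation
between the six diagrams id, E, I, H, N, P. Rotation by one click swaps id with E, I with H and N
with P, so a relation splits into a symmetric and an antisymmetric part. The Jacobi relation
expresses HN and HP through the six diagrams; the only new product with H is the square, and
rotation fixes it. Hence multiplying a relation by H and subtracting the rotated result gives an
antisymmetric relation between the same six diagrams (`rung_anti`, `rung_symm`). From any nontrivial
relation one reaches in this way the relation -αΨ₁(id - E) + (I - H) + B(N - P) = 0 with B = (b +
αΨ₁Ψ₃)/(Ψ₁Ψ₂Ψ₃Ψ₄) (`FourBox.crossing`). Multiplying it by H computes the square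
(`FourBox.square_eq`). Degenerate cases are excluded by the scalar equations obtained on closing a
relation with a cup or a vertex; there v¹⁰ ≠ 1 and v¹² ≠ 1 enter.

Closing the Jacobi relation in the same two ways determines d and t from v, α, b. Multiplying the
cup by k and the cap by k⁻¹, with τ fixed, multiplies I, H, b, t, α and B by k and leaves d alone.
Choose k with kB = Ψ₆/Ψ₁, which requires B ≠ 0 (`FourBox.crossCoeff_ne`), and w with [λ][λ-1] =
-kαΨ₁ (`exists_lamProd_eq`); then all constants are those of the quantum exceptional category. An
evaluation functor fixes the images of strand and vertex but not of cup and cap, so the rescaling is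
harmless. The isotopy relations that are not laws of ribbon categories, rotation of the vertex and
the value of a curl, follow from one-dimensionality of C(2) and C(3) (`vertex_rotation`,
`twist_eq`). -/

namespace TriDiag

/-! ### Planar calculus of a rotation-invariant vertex. -/

section Planar

variable {C : Type u₁} [Category.{v₁} C] [MonoidalCategory C] (X : C) [ExactPairing X X]

/-- The vertex with one leg down and two legs up. -/
def coprod (τ : X ⊗ X ⟶ X) : X ⟶ X ⊗ X :=
  (λ_ X).inv ≫ η_ X X ▷ X ≫ (α_ X X X).hom ≫ X ◁ τ

/-- Two vertical strands joined by a rung. -/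
def rung (τ : X ⊗ X ⟶ X) : X ⊗ X ⟶ X ⊗ X :=
  X ◁ coprod X τ ≫ (α_ X X X).inv ≫ τ ▷ X

/-- Rotation by one click of a morphism with four legs. -/
def click (f : X ⊗ X ⟶ X ⊗ X) : X ⊗ X ⟶ X ⊗ X :=
  ((λ_ (X ⊗ X)).inv ≫ η_ X X ▷ (X ⊗ X) ≫ (α_ X X (X ⊗ X)).hom ≫ X ◁ (α_ X X X).inv) ≫
    X ◁ f ▷ X ≫ (X ◁ (α_ X X X).hom ≫ (α_ X X (X ⊗ X)).inv ≫ (X ⊗ X) ◁ ε_ X X ≫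
      (ρ_ (X ⊗ X)).hom)

variable {X} {τ : X ⊗ X ⟶ X}

theorem zigzag_left : X ◁ η_ X X ⊗≫ ε_ X X ▷ X = ⊗𝟙.hom := by
  have := ExactPairing.coevaluation_evaluation X X
  calc _ = X ◁ η_ X X ≫ (α_ X X X).inv ≫ ε_ X X ▷ X := by monoidal
    _ = _ := by rw [this]; monoidal

theorem zigzag_right : η_ X X ▷ X ⊗≫ X ◁ ε_ X X = ⊗𝟙.hom := by
  have := ExactPairing.evaluation_coevaluation X X
  calc _ = η_ X X ▷ X ≫ (α_ X X X).hom ≫ X ◁ ε_ X X := by monoidal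
    _ = _ := by rw [this]; monoidal

/-- The hypothesis `rot`, carried through this section, is rotation invariance of the vertex. It
moves the cap to the other side of `τ`, after which a single zigzag straightens. -/
theorem coprod_whisker_cap (rot : X ◁ τ ≫ ε_ X X = (α_ X X X).inv ≫ τ ▷ X ≫ ε_ X X) :
    coprod X τ ▷ X ≫ (α_ X X X).hom ≫ X ◁ ε_ X X ≫ (ρ_ X).hom = τ := by
  calc _ = 𝟙 _ ⊗≫ η_ X X ▷ (X ⊗ X) ⊗≫ X ◁ ((α_ X X X).inv ≫ τ ▷ X ≫ ε_ X X) ⊗≫ 𝟙 X := by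
        rw [coprod]; monoidal
    _ = 𝟙 _ ⊗≫ (η_ X X ▷ (X ⊗ X) ≫ (X ⊗ X) ◁ τ) ⊗≫ X ◁ ε_ X X ⊗≫ 𝟙 X := by
        rw [← rot]; monoidal
    _ = τ ⊗≫ (η_ X X ▷ X ⊗≫ X ◁ ε_ X X) ⊗≫ 𝟙 X := by
        rw [← whisker_exchange]; monoidal
    _ = τ := by rw [zigzag_right]; monoidal

/-- By definition the incoming strand meets the right leg of a cup on its left; with `rot` it may as
well meet the left leg of a cup on its right. This symmetry gives the rung its second form in
`rung_eq`. -/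
theorem coprod_eq (rot : X ◁ τ ≫ ε_ X X = (α_ X X X).inv ≫ τ ▷ X ≫ ε_ X X) :
    coprod X τ = (ρ_ X).inv ≫ X ◁ η_ X X ≫ (α_ X X X).inv ≫ τ ▷ X := by
  symm
  calc _ = 𝟙 _ ⊗≫ X ◁ η_ X X ⊗≫
        (coprod X τ ▷ X ≫ (α_ X X X).hom ≫ X ◁ ε_ X X ≫ (ρ_ X).hom) ▷ X := by
        rw [coprod_whisker_cap rot]; monoidal
    _ = 𝟙 _ ⊗≫ (X ◁ η_ X X ≫ coprod X τ ▷ (X ⊗ X)) ⊗≫ X ◁ ε_ X X ▷ X ⊗≫ 𝟙 _ := by monoidal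
    _ = coprod X τ ⊗≫ X ◁ (X ◁ η_ X X ⊗≫ ε_ X X ▷ X) ⊗≫ 𝟙 _ := by
        rw [whisker_exchange]; monoidal
    _ = _ := by rw [zigzag_left]; monoidal

theorem cup_whisker_vertex : η_ X X ▷ X ≫ (α_ X X X).hom ≫ X ◁ τ = (λ_ X).hom ≫ coprod X τ := by
  simp [coprod]

theorem whisker_cup_vertex (rot : X ◁ τ ≫ ε_ X X = (α_ X X X).inv ≫ τ ▷ X ≫ ε_ X X) :
    X ◁ η_ X X ≫ (α_ X X X).inv ≫ τ ▷ X = (ρ_ X).hom ≫ coprod X τ := by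
  simp [coprod_eq rot]

theorem rung_eq (rot : X ◁ τ ≫ ε_ X X = (α_ X X X).inv ≫ τ ▷ X ≫ ε_ X X) :
    rung X τ = coprod X τ ▷ X ≫ (α_ X X X).hom ≫ X ◁ τ := by
  calc _ = 𝟙 _ ⊗≫ X ◁ η_ X X ▷ X ⊗≫ ((X ⊗ X) ◁ τ ≫ τ ▷ X) := by
        rw [rung, coprod]; monoidal
    _ = 𝟙 _ ⊗≫ ((X ◁ η_ X X ≫ (α_ X X X).inv ≫ τ ▷ X) ▷ X) ⊗≫ X ◁ τ := by
        rw [whisker_exchange]; monoidal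
    _ = _ := by rw [whisker_cup_vertex rot]; monoidal

/-- Supplies the `rotate` relation of `Rel`. -/
theorem rotated_vertex (rot : X ◁ τ ≫ ε_ X X = (α_ X X X).inv ≫ τ ▷ X ≫ ε_ X X) :
    𝟙 _ ⊗≫ (X ⊗ X) ◁ η_ X X ⊗≫ X ◁ τ ▷ X ⊗≫ ε_ X X ▷ X ⊗≫ 𝟙 X = τ := by
  calc _ = 𝟙 _ ⊗≫ (X ⊗ X) ◁ η_ X X ⊗≫ (X ◁ τ ≫ ε_ X X) ▷ X ⊗≫ 𝟙 X := by monoidal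
    _ = 𝟙 _ ⊗≫ ((X ⊗ X) ◁ η_ X X ≫ τ ▷ (X ⊗ X)) ⊗≫ ε_ X X ▷ X ⊗≫ 𝟙 X := by
        rw [rot]; monoidal
    _ = τ ⊗≫ (X ◁ η_ X X ⊗≫ ε_ X X ▷ X) ⊗≫ 𝟙 X := by rw [whisker_exchange]; monoidal
    _ = τ := by rw [zigzag_left]; monoidal

theorem click_id : click X (𝟙 (X ⊗ X)) = ε_ X X ≫ η_ X X := by
  calc _ = 𝟙 _ ⊗≫ (η_ X X ▷ (X ⊗ X) ≫ (X ⊗ X) ◁ ε_ X X) ⊗≫ 𝟙 _ := by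
        rw [click]; monoidal
    _ = _ := by rw [← whisker_exchange]; monoidal

theorem click_cap_cup : click X (ε_ X X ≫ η_ X X) = 𝟙 (X ⊗ X) := by
  calc _ = 𝟙 _ ⊗≫ (η_ X X ▷ X ⊗≫ X ◁ ε_ X X) ▷ X ⊗≫ X ◁ (η_ X X ▷ X ⊗≫ X ◁ ε_ X X) ⊗≫ 𝟙 _ := by
        rw [click]; monoidal
    _ = _ := by rw [zigzag_right]; monoidal

theorem click_vertex_coprod (rot : X ◁ τ ≫ ε_ X X = (α_ X X X).inv ≫ τ ▷ X ≫ ε_ X X) :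
    click X (τ ≫ coprod X τ) = rung X τ := by
  calc _ = 𝟙 _ ⊗≫ (η_ X X ▷ X ≫ (α_ X X X).hom ≫ X ◁ τ) ▷ X ⊗≫
        X ◁ (coprod X τ ▷ X ≫ (α_ X X X).hom ≫ X ◁ ε_ X X ≫ (ρ_ X).hom) := by
        rw [click]; monoidal
    _ = _ := by
        rw [cup_whisker_vertex, coprod_whisker_cap rot, rung_eq rot]; monoidal

theorem click_rung (rot : X ◁ τ ≫ ε_ X X = (α_ X X X).inv ≫ τ ▷ X ≫ ε_ X X) :
    click X (rung X τ) = τ ≫ coprod X τ := by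
  calc _ = 𝟙 _ ⊗≫ (η_ X X ▷ X ≫ (X ⊗ X) ◁ coprod X τ) ▷ X ⊗≫ X ◁ τ ▷ (X ⊗ X) ⊗≫
        (X ⊗ X) ◁ ε_ X X ⊗≫ 𝟙 _ := by
        rw [click, rung]; monoidal
    _ = 𝟙 _ ⊗≫ coprod X τ ▷ X ⊗≫ ((η_ X X ▷ X ≫ (α_ X X X).hom ≫ X ◁ τ) ▷ (X ⊗ X) ≫
          (X ⊗ X) ◁ ε_ X X) ⊗≫ 𝟙 _ := by
        rw [← whisker_exchange]; monoidal
    _ = 𝟙 _ ⊗≫ (coprod X τ ▷ X ≫ (α_ X X X).hom ≫ X ◁ ε_ X X ≫ (ρ_ X).hom) ⊗≫ coprod X τ := by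
        rw [← whisker_exchange, cup_whisker_vertex]; monoidal
    _ = _ := by rw [coprod_whisker_cap rot]; monoidal

/-- This invariance makes the square cancel in `rung_anti` and `rung_symm`. With one rung in its
defining form and the other in the form `rung_eq`, the cup and the cap of the rotation each stand
next to a vertex that absorbs them. -/
theorem click_square (rot : X ◁ τ ≫ ε_ X X = (α_ X X X).inv ≫ τ ▷ X ≫ ε_ X X) :
    click X (rung X τ ≫ rung X τ) = rung X τ ≫ rung X τ := by
  calc _ = 𝟙 _ ⊗≫ (η_ X X ▷ X ≫ (X ⊗ X) ◁ coprod X τ) ▷ X ⊗≫ X ◁ τ ▷ (X ⊗ X) ⊗≫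
        X ◁ coprod X τ ▷ X ▷ X ⊗≫ (X ⊗ X) ◁ (τ ▷ X ≫ ε_ X X) ⊗≫ 𝟙 _ := by
        rw [click]; nth_rw 2 [rung_eq rot]; rw [rung]; monoidal
    _ = 𝟙 _ ⊗≫ coprod X τ ▷ X ⊗≫ (η_ X X ▷ X ≫ (α_ X X X).hom ≫ X ◁ τ) ▷ (X ⊗ X) ⊗≫
        X ◁ coprod X τ ▷ X ▷ X ⊗≫ (X ⊗ X) ◁ ((α_ X X X).inv ≫ τ ▷ X ≫ ε_ X X) ⊗≫ 𝟙 _ := by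
        rw [← whisker_exchange]; monoidal
    _ = 𝟙 _ ⊗≫ coprod X τ ▷ X ⊗≫ coprod X τ ▷ (X ⊗ X) ⊗≫
        X ◁ (X ◁ τ ≫ coprod X τ ▷ X) ⊗≫ X ◁ X ◁ ε_ X X ⊗≫ 𝟙 _ := by
        rw [← rot, whisker_exchange (coprod X τ) τ, cup_whisker_vertex]; monoidal
    _ = 𝟙 _ ⊗≫ coprod X τ ▷ X ⊗≫ (coprod X τ ▷ (X ⊗ X) ≫ (X ⊗ X) ◁ τ) ⊗≫
        X ◁ (coprod X τ ▷ X ≫ (α_ X X X).hom ≫ X ◁ ε_ X X ≫ (ρ_ X).hom) := by monoidal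
    _ = _ := by
        rw [coprod_whisker_cap rot, ← whisker_exchange, rung_eq rot]; monoidal

theorem rung_cap (rot : X ◁ τ ≫ ε_ X X = (α_ X X X).inv ≫ τ ▷ X ≫ ε_ X X) :
    rung X τ ≫ ε_ X X = X ◁ (coprod X τ ≫ τ) ≫ ε_ X X := by
  rw [rung, Category.assoc, Category.assoc, ← rot, MonoidalCategory.whiskerLeft_comp,
    Category.assoc]

theorem cup_rung (rot : X ◁ τ ≫ ε_ X X = (α_ X X X).inv ≫ τ ▷ X ≫ ε_ X X) :
    η_ X X ≫ rung X τ = η_ X X ≫ (coprod X τ ≫ τ) ▷ X := by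
  calc _ = (η_ X X ⊗≫ (X ⊗ X) ◁ η_ X X) ⊗≫ X ◁ τ ▷ X ⊗≫ τ ▷ X := by
        rw [rung, coprod_eq rot]; monoidal
    _ = 𝟙 _ ⊗≫ (η_ X X ▷ 𝟙_ C ≫ (X ⊗ X) ◁ η_ X X) ⊗≫ X ◁ τ ▷ X ⊗≫ τ ▷ X := by monoidal
    _ = _ := by rw [← whisker_exchange, coprod]; monoidal

end Planar

/-! ### Bending legs. -/

section Duality

variable {C : Type u₁} [Category.{v₁} C] [MonoidalCategory C]

/-- A bent leg can be bent back by a zigzag. -/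
theorem eq_of_whiskerRight_cap {W Y Z : C} [ExactPairing Y Z] {f g : W ⟶ Z}
    (h : f ▷ Y ≫ ε_ Y Z = g ▷ Y ≫ ε_ Y Z) : f = g := by
  have key : ∀ k : W ⟶ Z,
      k = 𝟙 _ ⊗≫ W ◁ η_ Y Z ⊗≫ (k ▷ Y ≫ ε_ Y Z) ▷ Z ⊗≫ 𝟙 _ := fun k => by
    symm
    calc _ = 𝟙 _ ⊗≫ (W ◁ η_ Y Z ≫ k ▷ (Y ⊗ Z)) ⊗≫ ε_ Y Z ▷ Z ⊗≫ 𝟙 _ := by monoidal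
      _ = k ⊗≫ (Z ◁ η_ Y Z ⊗≫ ε_ Y Z ▷ Z) ⊗≫ 𝟙 _ := by rw [whisker_exchange]; monoidal
      _ = k := by rw [ExactPairing.coevaluation_evaluation'']; monoidal
  rw [key f, key g, h]

/-- Once the cup of the rotation has been pulled through `f`, its remaining leg forms a zigzag with
the cap. For crossings the hypothesis is naturality of the braiding at the cup. -/
theorem click_eq_of_cup {X : C} [ExactPairing X X] {f g : X ⊗ X ⟶ X ⊗ X}
    (h : η_ X X ▷ X ≫ (α_ X X X).hom ≫ X ◁ f =
      (λ_ X).hom ≫ (ρ_ X).inv ≫ X ◁ η_ X X ≫ (α_ X X X).inv ≫ g ▷ X ≫ (α_ X X X).hom) :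
    click X f = g := by
  calc _ = 𝟙 _ ⊗≫ (η_ X X ▷ X ≫ (α_ X X X).hom ≫ X ◁ f) ▷ X ⊗≫ (X ⊗ X) ◁ ε_ X X ⊗≫ 𝟙 _ := by
        rw [click]; monoidal
    _ = 𝟙 _ ⊗≫ X ◁ η_ X X ▷ X ⊗≫ (g ▷ (X ⊗ X) ≫ (X ⊗ X) ◁ ε_ X X) ⊗≫ 𝟙 _ := by
        rw [h]; monoidal
    _ = 𝟙 _ ⊗≫ X ◁ (η_ X X ▷ X ⊗≫ X ◁ ε_ X X) ⊗≫ g := by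
        rw [← whisker_exchange]; monoidal
    _ = _ := by rw [zigzag_right]; monoidal

end Duality

theorem FreelyGenerates.eq_smul {M : Type*} [AddCommGroup M] [Module ℂ M] {x : M}
    (h : FreelyGenerates x) (y : M) : ∃ c : ℂ, y = c • x :=
  (h.2 y).imp fun _ e => e.symm

theorem FreelyGenerates.ne_zero {M : Type*} [AddCommGroup M] [Module ℂ M] {x : M}
    (h : FreelyGenerates x) : x ≠ 0 := fun h0 =>
  one_ne_zero (h.1 (a₁ := (1 : ℂ)) (a₂ := 0) (by simp [h0]))

theorem hom_comp_eq_inv_smul {C : Type u₁} [Category.{v₁} C] [Preadditive C] [Linear ℂ C] {c : ℂ}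
    (hc : c ≠ 0) {Y Z : C} {f : Y ≅ Y} {g : Y ⟶ Z}
    (h : f.inv ≫ g = c • g) : f.hom ≫ g = c⁻¹ • g := by
  rw [Iso.inv_comp_eq, Linear.comp_smul] at h
  rw [eq_inv_smul_iff₀ hc, ← h]

/-! ### Consequences of the braiding: rotation invariance, eigenvalues of crossings, the twist. -/

section Braided

variable {C : Type u₁} [Category.{v₁} C] [MonoidalCategory C] [BraidedCategory C]
  {X : C} [ExactPairing X X] {τ : X ⊗ X ⟶ X}

open BraidedCategory

theorem cup_braiding : η_ X X ▷ X ≫ (α_ X X X).hom ≫ X ◁ (β_ X X).hom =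
    (λ_ X).hom ≫ (ρ_ X).inv ≫ X ◁ η_ X X ≫ (α_ X X X).inv ≫ (β_ X X).inv ▷ X ≫
      (α_ X X X).hom := by
  have := braiding_naturality_left (η_ X X) X
  rw [braiding_tensor_left_hom, braiding_tensorUnit_left] at this
  have h := congrArg (fun f => f ≫ (α_ _ _ _).inv ≫ (β_ X X).inv ▷ X ≫ (α_ _ _ _).hom) this
  simpa using h

theorem cup_braiding_inv : η_ X X ▷ X ≫ (α_ X X X).hom ≫ X ◁ (β_ X X).inv =
    (λ_ X).hom ≫ (ρ_ X).inv ≫ X ◁ η_ X X ≫ (α_ X X X).inv ≫ (β_ X X).hom ▷ X ≫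
      (α_ X X X).hom := by
  have := braiding_naturality_right X (η_ X X)
  rw [braiding_tensor_right_hom, braiding_tensorUnit_right] at this
  have h := congrArg (fun f => (λ_ X).hom ≫ (ρ_ X).inv ≫ f ≫ (α_ X X X).hom ≫
    X ◁ (β_ X X).inv) this
  simpa using h.symm

theorem click_braiding : click X (β_ X X).hom = (β_ X X).inv := click_eq_of_cup cup_braiding

theorem click_braiding_inv : click X (β_ X X).inv = (β_ X X).hom :=
  click_eq_of_cup cup_braiding_inv

variable [Preadditive C] [Linear ℂ C]

/-- The cap spans its space, so it is an eigenvector of the crossing; pairing with the cup, with `d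
≠ 0`, identifies the eigenvalue with that of the cup. -/
theorem cap_twist {c d : ℂ} (h0 : 𝟙 (𝟙_ C) ≠ 0) (h2 : FreelyGenerates (ε_ X X))
    (hd : d ≠ 0) (hcirc : η_ X X ≫ ε_ X X = d • 𝟙 (𝟙_ C))
    (hcup : η_ X X ≫ (β_ X X).inv = c • η_ X X) :
    (β_ X X).inv ≫ ε_ X X = c • ε_ X X := by
  obtain ⟨s, hs⟩ := h2.eq_smul ((β_ X X).inv ≫ ε_ X X)
  have h := congrArg (fun f => η_ X X ≫ f) hs
  simp only [reassoc_of% hcup, Linear.smul_comp, Linear.comp_smul, hcirc, smul_smul] at h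
  have := smul_left_injective ℂ h0 h
  rw [hs, mul_right_cancel₀ hd this]

variable [MonoidalPreadditive C] [MonoidalLinear ℂ C]

/-- The trivalent vertex is invariant under rotation. -/
theorem vertex_rotation {c d : ℂ} (hc : c ≠ 0) (h0 : 𝟙 (𝟙_ C) ≠ 0)
    (h2 : FreelyGenerates (ε_ X X)) (h3 : FreelyGenerates (τ ▷ X ≫ ε_ X X))
    (hd : d ≠ 0) (hcirc : η_ X X ≫ ε_ X X = d • 𝟙 (𝟙_ C))
    (hcup : η_ X X ≫ (β_ X X).inv = c ^ 2 • η_ X X) (hτ : (β_ X X).inv ≫ τ = c • τ) :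
    X ◁ τ ≫ ε_ X X = (α_ X X X).inv ≫ τ ▷ X ≫ ε_ X X := by
  have hne := h3.ne_zero
  have hτ' := hom_comp_eq_inv_smul hc hτ
  have hcap' := hom_comp_eq_inv_smul (pow_ne_zero 2 hc) (cap_twist h0 h2 hd hcirc hcup)
  set f := τ ▷ X ≫ ε_ X X with hf
  have h12 : (β_ X X).hom ▷ X ≫ f = c⁻¹ • f := by
    rw [hf, ← comp_whiskerRight_assoc, hτ', MonoidalLinear.smul_whiskerRight, Linear.smul_comp]
  -- The three-legged vertex spans its space, so crossing its last two legs and rotating it act by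
  -- scalars `s` and `ω`.
  obtain ⟨s, h23⟩ := h3.eq_smul ((α_ X X X).hom ≫ X ◁ (β_ X X).hom ≫ (α_ X X X).inv ≫ f)
  obtain ⟨ω, hω⟩ := h3.eq_smul ((α_ X X X).hom ≫ X ◁ τ ≫ ε_ X X)
  have hs : s ≠ 0 := by
    rintro rfl
    rw [zero_smul] at h23
    apply hne
    have := congrArg (fun g => (α_ X X X).hom ≫ X ◁ (β_ X X).inv ≫ (α_ X X X).inv ≫ g) h23
    simpa using this
  -- Yang–Baxter becomes an equation between scalars and forces `s = c⁻¹`.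
  have yb := congrArg (fun g => (α_ X X X).hom ≫ g ≫ (α_ X X X).inv ≫ f) (yang_baxter X X X)
  simp only [Category.assoc, Iso.hom_inv_id_assoc, h12, h23, Linear.comp_smul, smul_smul] at yb
  have e1 := smul_left_injective ℂ hne yb
  have hsc : s = c⁻¹ := by
    have : c⁻¹ ≠ 0 := inv_ne_zero hc
    apply mul_left_cancel₀ (mul_ne_zero hs this)
    linear_combination -e1
  -- Pulling the third strand past the vertex gives `ω s c⁻¹ = c⁻²`, the right side coming from the
  -- crossed cap.
  have nat := congrArg (fun g => g ≫ ε_ X X) (braiding_naturality_left τ X)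
  simp only [Category.assoc, hcap', braiding_tensor_left_hom, hω, h12, h23, Linear.comp_smul,
    smul_smul, ← hf] at nat
  have e2 := smul_left_injective ℂ hne nat
  have : ω = 1 := by
    rw [hsc] at e2
    field_simp at e2
    exact e2.symm
  rw [this, one_smul] at hω
  rw [← hω]; simp

/-- Naturality moves a positive crossing past `τ` and makes it two: one curls the cup, for a factor
c⁻², the other slides across the cup by `cup_braiding`, becomes negative and is absorbed by `τ`, for
a factor c. -/
theorem coprod_braiding_inv {c : ℂ} (hc : c ≠ 0)
    (rot : X ◁ τ ≫ ε_ X X = (α_ X X X).inv ≫ τ ▷ X ≫ ε_ X X)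
    (hcup : η_ X X ≫ (β_ X X).inv = c ^ 2 • η_ X X) (hτ : (β_ X X).inv ≫ τ = c • τ) :
    coprod X τ ≫ (β_ X X).inv = c • coprod X τ := by
  have hcup' : η_ X X ≫ (β_ X X).hom = (c ^ 2)⁻¹ • η_ X X := by
    rw [eq_inv_smul_iff₀ (pow_ne_zero 2 hc), ← Linear.smul_comp, ← hcup]; simp
  have h : coprod X τ ≫ (β_ X X).hom = c⁻¹ • coprod X τ := by
    calc _ = (λ_ X).inv ≫ (η_ X X ≫ (β_ X X).hom) ▷ X ≫ (α_ X X X).hom ≫ X ◁ (β_ X X).hom ≫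
          (α_ X X X).inv ≫ τ ▷ X := by
          simp [coprod, braiding_naturality_right, braiding_tensor_right_hom]
      _ = (c ^ 2)⁻¹ • (λ_ X).inv ≫ (η_ X X ▷ X ≫ (α_ X X X).hom ≫ X ◁ (β_ X X).hom) ≫
          (α_ X X X).inv ≫ τ ▷ X := by
          rw [hcup']; simp
      _ = (c ^ 2)⁻¹ • (ρ_ X).inv ≫ X ◁ η_ X X ≫ (α_ X X X).inv ≫ ((β_ X X).inv ≫ τ) ▷ X := by
          rw [cup_braiding]; simp
      _ = _ := by
          rw [hτ, coprod_eq rot]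
          simp only [MonoidalLinear.smul_whiskerRight, Linear.comp_smul, smul_smul]
          congr 1; field_simp
  rw [Iso.comp_inv_eq, Linear.smul_comp, h, smul_smul, mul_inv_cancel₀ hc, one_smul]

/-- The twist of `X` is a scalar `s` because Hom(X ⊗ X, 𝟙) is a line. A double crossing acts on `τ`
by c⁻², so naturality of the twist at `τ` reads s = s²c⁻². -/
theorem twist_eq [BalancedCategory C] {c : ℂ} (hc : c ≠ 0) (h2 : FreelyGenerates (ε_ X X))
    (hne : τ ≠ 0) (hτ : (β_ X X).inv ≫ τ = c • τ) :
    (BalancedCategory.twist X).hom = c ^ 2 • 𝟙 X := by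
  obtain ⟨s, hs⟩ := h2.eq_smul ((BalancedCategory.twist X).hom ▷ X ≫ ε_ X X)
  have hs' : (BalancedCategory.twist X).hom = s • 𝟙 X :=
    eq_of_whiskerRight_cap (by rw [hs]; simp)
  have hs0 : s ≠ 0 := by
    rintro rfl
    rw [zero_smul] at hs'
    apply hne
    rw [← Category.comp_id τ, ← (BalancedCategory.twist X).hom_inv_id, hs']
    simp
  have hτ' := hom_comp_eq_inv_smul hc hτ
  have nat := BalancedCategory.twist_naturality τ
  rw [BalancedCategory.twist_tensor, hs'] at nat
  simp only [Category.assoc, hτ', Linear.comp_smul, Linear.smul_comp, smul_smul,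
    MonoidalCategory.tensorHom_def, MonoidalLinear.smul_whiskerRight,
    MonoidalLinear.whiskerLeft_smul, MonoidalCategory.whiskerLeft_id,
    MonoidalCategory.id_whiskerRight, Category.id_comp, Category.comp_id] at nat
  have e := smul_left_injective ℂ hne nat
  rw [hs']
  congr 1
  apply mul_left_cancel₀ hs0
  field_simp at e
  linear_combination -s * e

end Braided

/-! ### Linear algebra of the six diagrams with four legs. -/

section LinearAlgebra

/-- The linear algebra of diagrams with four legs: the vectors `one`, `E`, `I`, `H`, `N`, `P`, `Q`
stand for two strands, the cap with a cup, `I`, `H`, the two crossings and the square, `rot` for the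
rotation by one click, `rungL` for precomposition with `H`, `crossR` for postcomposition with the
negative crossing, `onCup` for precomposition with the cup and `onVertex` for postcomposition with
the vertex. -/
structure FourBox (V M₁ M₂ : Type*) [AddCommGroup V] [Module ℂ V] [AddCommGroup M₁] [Module ℂ M₁]
    [AddCommGroup M₂] [Module ℂ M₂] (v α d b t : ℂ) where
  (one E I H N P Q : V)
  (rot rungL crossR : V →ₗ[ℂ] V)
  (onCup : V →ₗ[ℂ] M₁)
  (onVertex : V →ₗ[ℂ] M₂)
  (cup : M₁)
  (vertex : M₂)
  cup_ne : cup ≠ 0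
  vertex_ne : vertex ≠ 0
  rot_one : rot one = E
  rot_E : rot E = one
  rot_I : rot I = H
  rot_H : rot H = I
  rot_N : rot N = P
  rot_P : rot P = N
  rot_Q : rot Q = Q
  rungL_one : rungL one = H
  rungL_E : rungL E = b • E
  rungL_I : rungL I = t • I
  rungL_H : rungL H = Q
  rungL_N : rungL N = (-v ^ 4) • I + v ^ 2 • H - (α * v ^ 3) • N - (α * v ^ 7) • E - (α * v⁻¹) • one
  rungL_P : rungL P = v⁻¹ ^ 2 • H - v⁻¹ ^ 4 • I + (α * v⁻¹ ^ 3) • P + (α * v) • one +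
    (α * v⁻¹ ^ 7) • E
  crossR_one : crossR one = N
  crossR_E : crossR E = v ^ 12 • E
  crossR_I : crossR I = (-v ^ 6) • I
  crossR_H : crossR H = rungL N
  onCup_one : onCup one = cup
  onCup_E : onCup E = d • cup
  onCup_I : onCup I = 0
  onCup_H : onCup H = b • cup
  onCup_N : onCup N = v ^ 12 • cup
  onCup_P : onCup P = v⁻¹ ^ 12 • cup
  onVertex_one : onVertex one = vertex
  onVertex_E : onVertex E = 0
  onVertex_I : onVertex I = b • vertex
  onVertex_H : onVertex H = t • vertex
  onVertex_N : onVertex N = (-v ^ 6) • vertex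
  onVertex_P : onVertex P = (-v⁻¹ ^ 6) • vertex
  v_ne : v ≠ 0
  b_ne : b ≠ 0
  d_ne : d ≠ 0
  v10 : v ^ 10 ≠ 1
  v12 : v ^ 12 ≠ 1
  jacobi_cup : b * (v ^ 5 - v⁻¹ ^ 5) = -α * (v ^ 8 + d + v⁻¹ ^ 8)
  jacobi_vertex : t * (v ^ 2 + v⁻¹ ^ 2) = b - α * (v ^ 5 - v⁻¹ ^ 5)

namespace FourBox

variable {V M₁ M₂ : Type*} [AddCommGroup V] [Module ℂ V] [AddCommGroup M₁] [Module ℂ M₁]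
    [AddCommGroup M₂] [Module ℂ M₂] {v α d b t : ℂ} (S : FourBox V M₁ M₂ v α d b t)

/-- A combination of diagrams that is negated by the rotation. -/
def anti (a p c : ℂ) : V := a • (S.one - S.E) + p • (S.I - S.H) + c • (S.N - S.P)

/-- A combination of diagrams that is fixed by the rotation. -/
def symm (a p c : ℂ) : V := a • (S.one + S.E) + p • (S.I + S.H) + c • (S.N + S.P)

theorem onCup_anti {a p c : ℂ} (h : S.anti a p c = 0) :
    a * (1 - d) - p * b + c * (v ^ 12 - v⁻¹ ^ 12) = 0 := by
  have h1 := congrArg S.onCup h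
  simp only [anti, map_add, map_sub, map_smul, S.onCup_one, S.onCup_E, S.onCup_I, S.onCup_H,
    S.onCup_N, S.onCup_P, map_zero] at h1
  refine (smul_eq_zero_iff_left S.cup_ne).1 (Eq.trans ?_ h1)
  module

theorem onVertex_anti {a p c : ℂ} (h : S.anti a p c = 0) :
    a + p * (b - t) - c * (v ^ 6 - v⁻¹ ^ 6) = 0 := by
  have h1 := congrArg S.onVertex h
  simp only [anti, map_add, map_sub, map_smul, S.onVertex_one, S.onVertex_E, S.onVertex_I,
    S.onVertex_H, S.onVertex_N, S.onVertex_P, map_zero] at h1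
  refine (smul_eq_zero_iff_left S.vertex_ne).1 (Eq.trans ?_ h1)
  module

/-- Multiply by H and subtract the rotated relation: the square has coefficient -p in both and
cancels. -/
theorem rung_anti {a p c : ℂ} (h : S.anti a p c = 0) :
    S.anti (c * α * (v ^ 7 + v⁻¹ ^ 7 - v - v⁻¹) + a * b)
      (p * t - a - c * (v ^ 4 - v⁻¹ ^ 4) - c * (v ^ 2 - v⁻¹ ^ 2))
      (-(c * α * (v ^ 3 - v⁻¹ ^ 3))) = 0 := by
  have h1 := congrArg S.rungL h
  simp only [anti, map_add, map_sub, map_smul, S.rungL_one, S.rungL_E, S.rungL_I, S.rungL_H,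
    S.rungL_N, S.rungL_P, map_zero] at h1
  have h2 := congrArg S.rot h1
  simp only [map_add, map_sub, map_smul, S.rot_one, S.rot_E, S.rot_I, S.rot_H, S.rot_N, S.rot_P,
    S.rot_Q, map_zero] at h2
  have h3 := congrArg₂ (· - ·) h1 h2
  simp only [sub_zero] at h3
  refine Eq.trans ?_ h3
  rw [anti]
  module

/-- The same operation turns symmetric relations into antisymmetric ones. -/
theorem rung_symm {a p c : ℂ} (h : S.symm a p c = 0) :
    S.anti (c * α * (v - v⁻¹ + v ^ 7 - v⁻¹ ^ 7) - a * b)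
      (p * t - a - c * (v ^ 4 + v⁻¹ ^ 4) - c * (v ^ 2 + v⁻¹ ^ 2))
      (-(c * α * (v ^ 3 + v⁻¹ ^ 3))) = 0 := by
  have h1 := congrArg S.rungL h
  simp only [symm, map_add, map_smul, S.rungL_one, S.rungL_E, S.rungL_I, S.rungL_H,
    S.rungL_N, S.rungL_P, map_zero] at h1
  have h2 := congrArg S.rot h1
  simp only [map_add, map_sub, map_smul, S.rot_one, S.rot_E, S.rot_I, S.rot_H, S.rot_N, S.rot_P,
    S.rot_Q, map_zero] at h2
  have h3 := congrArg₂ (· - ·) h1 h2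
  simp only [sub_zero] at h3
  refine Eq.trans ?_ h3
  rw [anti]
  module

theorem onCup_symm {a p c : ℂ} (h : S.symm a p c = 0) :
    a * (1 + d) + p * b + c * (v ^ 12 + v⁻¹ ^ 12) = 0 := by
  have h1 := congrArg S.onCup h
  simp only [symm, map_add, map_smul, S.onCup_one, S.onCup_E, S.onCup_I, S.onCup_H,
    S.onCup_N, S.onCup_P, map_zero] at h1
  refine (smul_eq_zero_iff_left S.cup_ne).1 (Eq.trans ?_ h1)
  module

/-- The analogue of `rung_anti` for the negative crossing; without an N - P term, N² does not arise.
-/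
theorem cross_anti {a p : ℂ} (h : S.anti a p 0 = 0) :
    S.anti (p * α * (v⁻¹ - v ^ 7) + a * v ^ 12) (p * (v ^ 4 + v ^ 2 - v ^ 6))
      (a + p * α * v ^ 3) = 0 := by
  have h1 := congrArg S.crossR h
  simp only [anti, map_add, map_sub, map_smul, S.crossR_one, S.crossR_E, S.crossR_I, S.crossR_H,
    S.rungL_N, map_zero, zero_smul, add_zero] at h1
  have h2 := congrArg S.rot h1
  simp only [map_add, map_sub, map_smul, S.rot_one, S.rot_E, S.rot_I, S.rot_H, S.rot_N, map_zero]
    at h2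
  have h3 := congrArg₂ (· - ·) h1 h2
  simp only [sub_zero] at h3
  refine Eq.trans ?_ h3
  rw [anti]
  module

include S in
theorem psi5_ne : v ^ 5 - v⁻¹ ^ 5 ≠ 0 := by
  intro h0
  have := S.v_ne
  field_simp at h0
  exact S.v10 (by linear_combination h0)

-- With α = 0, `jacobi_cup` would read b(v⁵ - v⁻⁵) = 0.
include S in
theorem alpha_ne : α ≠ 0 := by
  rintro rfl
  have h := S.jacobi_cup
  have := mul_ne_zero S.b_ne S.psi5_ne
  simp_all

-- Up to powers of v, Ψ₁, Ψ₂, Ψ₃, Ψ₆ are the factors of v¹² - 1 = (u - 1)(u + 1)(u² + u + 1)(u² - u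
-- + 1), where u = v².
include S in
theorem psi1_ne : psi1 v ≠ 0 := by
  intro h0
  have := S.v_ne
  rw [psi1] at h0
  field_simp at h0
  exact S.v12 (by linear_combination (v ^ 10 + v ^ 8 + v ^ 6 + v ^ 4 + v ^ 2 + 1) * h0)

include S in
theorem psi2_ne : psi2 v ≠ 0 := by
  intro h0
  have := S.v_ne
  rw [psi2] at h0
  field_simp at h0
  exact S.v12 (by linear_combination (v ^ 10 - v ^ 8 + v ^ 6 - v ^ 4 + v ^ 2 - 1) * h0)

include S in
theorem psi3_ne : psi3 v ≠ 0 := by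
  intro h0
  have := S.v_ne
  rw [psi3] at h0
  field_simp at h0
  exact S.v12 (by linear_combination (v ^ 2 - 1) * (v ^ 6 + 1) * h0)

include S in
theorem psi6_ne : psi6 v ≠ 0 := by
  intro h0
  have := S.v_ne
  rw [psi6] at h0
  field_simp at h0
  exact S.v12 (by linear_combination (v ^ 2 + 1) * (v ^ 6 - 1) * h0)

-- Here v⁴ + 1 is not a factor of v¹² - 1. Instead, if Ψ₄ = 0, the two closings of the Jacobi
-- relation give d = -(v⁵ - v⁻⁵)² - v⁸ - v⁻⁸, which vanishes when v⁴ = -1.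
include S in
theorem psi4_ne : psi4 v ≠ 0 := by
  intro h0
  have hv := S.v_ne
  have h1 := S.jacobi_cup
  have h2 := S.jacobi_vertex
  have h3 : v ^ 2 + v⁻¹ ^ 2 = 0 := by simpa [psi4, zpow_neg] using h0
  rw [h3, mul_zero] at h2
  have hb : b = α * (v ^ 5 - v⁻¹ ^ 5) := by linear_combination -h2
  rw [hb] at h1
  have h4 : d = -(v ^ 5 - v⁻¹ ^ 5) ^ 2 - v ^ 8 - v⁻¹ ^ 8 := by
    apply mul_left_cancel₀ S.alpha_ne
    linear_combination h1
  apply S.d_ne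
  have h5 : v ^ 4 = -1 := by field_simp at h3; linear_combination h3
  have h6 : v⁻¹ = -v ^ 3 := by field_simp; linear_combination h5
  rw [h4, h6, show -(v ^ 5 - (-v ^ 3) ^ 5) ^ 2 - v ^ 8 - (-v ^ 3) ^ 8 = -(v ^ 4) ^ 2 * v ^ 2 -
    2 * (v ^ 4) ^ 5 - (v ^ 4) ^ 7 * v ^ 2 - (v ^ 4) ^ 2 - (v ^ 4) ^ 6 by ring, h5]
  ring

theorem prod_psi_eq (hv : v ≠ 0) : psi1 v * psi2 v * psi3 v * psi4 v =
    v ^ 6 + v ^ 4 + v ^ 2 - v⁻¹ ^ 2 - v⁻¹ ^ 4 - v⁻¹ ^ 6 := by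
  simp only [psi1, psi2, psi3, psi4]
  field_simp
  ring

theorem psi1_mul_psi3 (hv : v ≠ 0) : psi1 v * psi3 v = v ^ 3 - v⁻¹ ^ 3 := by
  simp only [psi1, psi3]
  field_simp
  ring

include S in
theorem prod_psi_ne : psi1 v * psi2 v * psi3 v * psi4 v ≠ 0 :=
  mul_ne_zero (mul_ne_zero (mul_ne_zero S.psi1_ne S.psi2_ne) S.psi3_ne) S.psi4_ne

/-- The coefficient of the difference of the crossings in the crossing relation. -/
noncomputable def crossCoeff (v α b : ℂ) : ℂ :=
  (b + α * (psi1 v * psi3 v)) / (psi1 v * psi2 v * psi3 v * psi4 v)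

include S in
theorem crossCoeff_mul : crossCoeff v α b * (psi1 v * psi2 v * psi3 v * psi4 v) =
    b + α * (psi1 v * psi3 v) := by
  rw [crossCoeff, div_mul_cancel₀ _ S.prod_psi_ne]

/-- Take b times the given relation minus the one from `rung_anti`. The coefficient a cancels or,
together with p, is eliminated by `onVertex_anti`; what remains is c Ψ₁Ψ₂Ψ₃Ψ₄ times the claim. -/
theorem crossing_of_anti {a p c : ℂ} (hc : c ≠ 0) (h : S.anti a p c = 0) :
    S.anti (-(α * psi1 v)) 1 (crossCoeff v α b) = 0 := by
  have hv := S.v_ne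
  have h2 := S.rung_anti h
  have hB := S.crossCoeff_mul
  have hG := S.prod_psi_ne
  have hvert := S.onVertex_anti h
  have hGe := prod_psi_eq hv
  rw [psi1_mul_psi3 hv] at hB
  set G := psi1 v * psi2 v * psi3 v * psi4 v
  have hG1 : G * psi1 v = v ^ 7 + v⁻¹ ^ 7 - v - v⁻¹ := by
    rw [hGe, psi1]
    field_simp
    ring
  have hx : S.anti (-(α * psi1 v)) 1 (crossCoeff v α b) = (c * G)⁻¹ • (
      (b + α * (v ^ 3 - v⁻¹ ^ 3)) • S.anti a p c -
      (S.anti (c * α * (v ^ 7 + v⁻¹ ^ 7 - v - v⁻¹) + a * b)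
      (p * t - a - c * (v ^ 4 - v⁻¹ ^ 4) - c * (v ^ 2 - v⁻¹ ^ 2))
      (-(c * α * (v ^ 3 - v⁻¹ ^ 3))) + (α * (v ^ 3 - v⁻¹ ^ 3)) • S.anti a p c)) := by
    rw [eq_inv_smul_iff₀ (mul_ne_zero hc hG)]
    have e1 : c * G * -(α * psi1 v) = b * a -
      (c * α * (v ^ 7 + v⁻¹ ^ 7 - v - v⁻¹) + a * b) := by linear_combination (-c * α) * hG1
    have e2 : c * G * 1 = b * p -
      (p * t - a - c * (v ^ 4 - v⁻¹ ^ 4) - c * (v ^ 2 - v⁻¹ ^ 2)) := by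
      linear_combination c * hGe - hvert
    have e3 : c * G * crossCoeff v α b = b * c + c * α * (v ^ 3 - v⁻¹ ^ 3) := by
      linear_combination c * hB
    calc _ = (c * G * -(α * psi1 v)) • (S.one - S.E) + (c * G * 1) • (S.I - S.H) +
          (c * G * crossCoeff v α b) • (S.N - S.P) := by rw [anti]; module
      _ = _ := by rw [e1, e2, e3]; simp only [anti]; module
  rw [hx, h, h2]
  simp

/-- When c = 0, multiplying by a crossing creates an N - P term with coefficient a + pαv³. If that
vanished too, the cup and vertex closings would be inconsistent. -/
theorem crossing_of_anti_ne {a p c : ℂ} (hne : a ≠ 0 ∨ p ≠ 0 ∨ c ≠ 0) (h : S.anti a p c = 0) :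
    S.anti (-(α * psi1 v)) 1 (crossCoeff v α b) = 0 := by
  by_cases hc : c ≠ 0
  · exact S.crossing_of_anti hc h
  push Not at hc
  subst hc
  refine S.crossing_of_anti ?_ (S.cross_anti h)
  have hv := S.v_ne
  have hvert := S.onVertex_anti h
  have hcup := S.onCup_anti h
  intro h0
  have hp : p ≠ 0 := by
    rintro rfl
    simp only [zero_mul, add_zero, sub_zero] at hvert
    simp [hvert] at hne
  have hbt : b - t = α * v ^ 3 := by
    apply mul_left_cancel₀ hp
    linear_combination hvert - h0
  have hd : (b - t) * (d - 1) = b := by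
    apply mul_left_cancel₀ hp
    linear_combination hcup - (1 - d) * hvert
  have h1 := S.jacobi_cup
  have h2 := S.jacobi_vertex
  -- Eliminating b, t and d leaves an expression in α and v alone, equal to α²v⁵Ψ₆²(v⁵ - v⁻⁵).
  have key : α ^ 2 * ((v ^ 3 - psi1 v) * (v ^ 3 * psi1 v * psi4 v + 1) *
      (v ^ 5 - v⁻¹ ^ 5)) = 0 := by
    have hF : ((b - t) * (v ^ 2 + v⁻¹ ^ 2) - α * (v ^ 5 - v⁻¹ ^ 5)) *
        ((b - t) * (v ^ 5 - v⁻¹ ^ 5) + α) +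
        α * (b - t) * (v ^ 8 + 1 + v⁻¹ ^ 8) * (v ^ 2 + v⁻¹ ^ 2 - 1) = 0 := by
      linear_combination (-((b - t) * (v ^ 5 - v⁻¹ ^ 5) + α)) * h2 +
        (v ^ 2 + v⁻¹ ^ 2 - 1) * ((b - t) * h1 - α * hd)
    rw [hbt] at hF
    rw [← mul_zero (psi1 v), ← hF]
    simp only [psi1, psi4]
    field_simp
    ring
  have e1 : v ^ 3 - psi1 v = v * psi6 v := by
    simp only [psi1, psi6]; field_simp; ring
  have e2 : v ^ 3 * psi1 v * psi4 v + 1 = v ^ 4 * psi6 v := by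
    simp only [psi1, psi4, psi6]; field_simp; ring
  rw [e1, e2] at key
  exact mul_ne_zero (pow_ne_zero 2 S.alpha_ne) (mul_ne_zero (mul_ne_zero
    (mul_ne_zero hv S.psi6_ne) (mul_ne_zero (pow_ne_zero 4 hv) S.psi6_ne)) S.psi5_ne) key

/-- If B = 0, `cross_anti` yields a second relation, with N - P coefficient αvΨ₆ ≠ 0. Closing both
relations determines d through (v⁶ - v⁻⁶)(1 - d) + v¹² - v⁻¹² = 0, whereas b = -αΨ₁Ψ₃ and
`jacobi_cup` give d = -(v² + v⁻²). These are incompatible. -/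
theorem crossCoeff_ne (h : S.anti (-(α * psi1 v)) 1 (crossCoeff v α b) = 0) :
    crossCoeff v α b ≠ 0 := by
  intro h0
  have hv := S.v_ne
  have hB := S.crossCoeff_mul
  rw [h0, zero_mul, psi1_mul_psi3 hv] at hB
  rw [h0] at h
  have h3 := S.cross_anti h
  have hcup := S.onCup_anti h3
  have hvert := S.onVertex_anti h3
  have hcup0 := S.onCup_anti h
  have hvert0 := S.onVertex_anti h
  have h1 := S.jacobi_cup
  set p := 1 * (v ^ 4 + v ^ 2 - v ^ 6)
  have hc : -(α * psi1 v) + 1 * α * v ^ 3 = α * (v * psi6 v) := by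
    simp only [psi1, psi6]; field_simp; ring
  rw [hc] at hcup hvert
  have hc0 : α * (v * psi6 v) ≠ 0 := mul_ne_zero S.alpha_ne (mul_ne_zero hv S.psi6_ne)
  have hd : (v ^ 6 - v⁻¹ ^ 6) * (1 - d) + (v ^ 12 - v⁻¹ ^ 12) = 0 := by
    apply mul_left_cancel₀ hc0
    linear_combination hcup - (1 - d) * hvert - p * hcup0 + (1 - d) * p * hvert0
  have hd' : d = -(v ^ 2 + v⁻¹ ^ 2) := by
    apply mul_left_cancel₀ S.alpha_ne
    have hb : b = -(α * (v ^ 3 - v⁻¹ ^ 3)) := by linear_combination -hB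
    rw [hb] at h1
    have e : (v ^ 3 - v⁻¹ ^ 3) * (v ^ 5 - v⁻¹ ^ 5) = v ^ 8 + v⁻¹ ^ 8 - v ^ 2 - v⁻¹ ^ 2 := by
      field_simp; ring
    linear_combination h1 + α * e
  have key : (psi1 v * psi2 v * psi3 v * psi6 v) * (psi6 v * (v ^ 5 - v⁻¹ ^ 5)) = 0 := by
    have e : (psi1 v * psi2 v * psi3 v * psi6 v) * (psi6 v * (v ^ 5 - v⁻¹ ^ 5)) =
      psi1 v * ((v ^ 6 - v⁻¹ ^ 6) * (1 + v ^ 2 + v⁻¹ ^ 2) + (v ^ 12 - v⁻¹ ^ 12)) := by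
      simp only [psi1, psi2, psi3, psi6]
      field_simp; ring
    rw [e]
    rw [hd'] at hd
    linear_combination psi1 v * hd
  exact mul_ne_zero (mul_ne_zero (mul_ne_zero (mul_ne_zero S.psi1_ne S.psi2_ne) S.psi3_ne)
    S.psi6_ne) (mul_ne_zero S.psi6_ne S.psi5_ne) key

/-- The relation from `rung_symm` is nontrivial: otherwise c = 0 since αΨ₂Ψ₆ ≠ 0, then a = 0 since b
≠ 0, and then closing with the cup gives p = 0. -/
theorem crossing_of_symm_ne {a p c : ℂ} (hne : a ≠ 0 ∨ p ≠ 0 ∨ c ≠ 0) (h : S.symm a p c = 0) :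
    S.anti (-(α * psi1 v)) 1 (crossCoeff v α b) = 0 := by
  have hv := S.v_ne
  refine S.crossing_of_anti_ne ?_ (S.rung_symm h)
  by_contra! h0
  obtain ⟨h1, h2, h3⟩ := h0
  have h33 : v ^ 3 + v⁻¹ ^ 3 = psi2 v * psi6 v := by
    simp only [psi2, psi6]; field_simp; ring
  rw [h33] at h3
  have hc : c = 0 := by
    by_contra hc
    exact neg_ne_zero.2 (mul_ne_zero (mul_ne_zero hc S.alpha_ne)
      (mul_ne_zero S.psi2_ne S.psi6_ne)) h3
  subst hc
  have ha : a = 0 := by simpa [S.b_ne] using h1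
  subst ha
  have hp : p = 0 := by simpa [S.b_ne] using S.onCup_symm h
  simp [hp] at hne

theorem crossing {g : Fin 6 → ℂ} (hg : g ≠ 0)
    (h : ∑ i, g i • ![S.one, S.E, S.I, S.H, S.N, S.P] i = 0) :
    S.anti (-(α * psi1 v)) 1 (crossCoeff v α b) = 0 := by
  simp only [Fin.sum_univ_six, Matrix.cons_val] at h
  have h2 := congrArg S.rot h
  simp only [map_add, map_smul, S.rot_one, S.rot_E, S.rot_I, S.rot_H, S.rot_N, S.rot_P, map_zero]
    at h2
  have ha : S.anti (g 0 - g 1) (g 2 - g 3) (g 4 - g 5) = 0 := by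
    refine Eq.trans ?_ (congrArg₂ (· - ·) h h2 |>.trans (sub_zero 0))
    rw [anti]; module
  have hs : S.symm (g 0 + g 1) (g 2 + g 3) (g 4 + g 5) = 0 := by
    refine Eq.trans ?_ (congrArg₂ (· + ·) h h2 |>.trans (add_zero 0))
    rw [symm]; module
  by_cases h1 : g 0 - g 1 ≠ 0 ∨ g 2 - g 3 ≠ 0 ∨ g 4 - g 5 ≠ 0
  · exact S.crossing_of_anti_ne h1 ha
  · refine S.crossing_of_symm_ne ?_ hs
    by_contra! h3
    push Not at h1
    obtain ⟨x1, x2, x3⟩ := h1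
    obtain ⟨y1, y2, y3⟩ := h3
    apply hg
    ext i
    fin_cases i <;> simp only [Fin.zero_eta, Fin.mk_one, Fin.reduceFinMk, Pi.zero_apply]
    · linear_combination (x1 + y1) / 2
    · linear_combination (y1 - x1) / 2
    · linear_combination (x2 + y2) / 2
    · linear_combination (y2 - x2) / 2
    · linear_combination (x3 + y3) / 2
    · linear_combination (y3 - x3) / 2

/-- The square in terms of the other diagrams, from the crossing relation. -/
theorem square_eq (h : S.anti (-(α * psi1 v)) 1 (crossCoeff v α b) = 0) :
    S.Q = crossCoeff v α b • (S.rungL S.N - S.rungL S.P) - (α * psi1 v) • (S.H - b • S.E) +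
      t • S.I := by
  have h1 := congrArg S.rungL h
  simp only [anti, map_add, map_sub, map_smul, S.rungL_one, S.rungL_E, S.rungL_I, S.rungL_H,
    map_zero] at h1
  rw [← sub_eq_zero, ← neg_eq_zero, ← h1]
  module

end FourBox

end LinearAlgebra

/-! ### Evaluation of the basic diagrams. -/

section Eval

variable {C : Type u₁} [Category.{v₁} C] [Preadditive C] [Linear ℂ C] [MonoidalCategory C]
  [BraidedCategory C] [BalancedCategory C] (X : C) [ExactPairing X X] (τ : X ⊗ X ⟶ X)

theorem eval_split : @Eq (X ⟶ X ⊗ X) (Diag.split.eval X τ) (coprod X τ) := by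
  simp [Diag.split, Diag.eval, coprod, Pts.eval]

theorem eval_I : @Eq (X ⊗ X ⟶ X ⊗ X) (Diag.I.eval X τ) (τ ≫ coprod X τ) := by
  rw [← eval_split]; rfl

theorem eval_H : @Eq (X ⊗ X ⟶ X ⊗ X) (Diag.H.eval X τ) (rung X τ) := by
  simp [Diag.H, Diag.eval, rung, Pts.eval, eval_split]

theorem eval_add {A B : Pts} (f g : Diag A B) : (f + g).eval X τ = f.eval X τ + g.eval X τ := rfl

theorem eval_smul {A B : Pts} (c : ℂ) (f : Diag A B) : (c • f).eval X τ = c • f.eval X τ := rfl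

theorem eval_qeJac (v α : ℂ) : @Eq (X ⊗ X ⟶ X ⊗ X) ((Diag.qeJac v α).eval X τ)
    (v ^ (-3 : ℤ) • (rung X τ ≫ (β_ X X).inv) + v • (τ ≫ coprod X τ) + (-v⁻¹) • rung X τ +
      α • ((β_ X X).inv + v ^ (4 : ℤ) • (ε_ X X ≫ η_ X X) + v ^ (-4 : ℤ) • 𝟙 (X ⊗ X))) := by
  rw [← eval_I, ← eval_H]; rfl

end Eval

/-! ### The six diagrams of a trivalent ribbon category as a `FourBox`. -/

section Construction

variable {C : Type u₁} [Category.{v₁} C] [Preadditive C] [Linear ℂ C] [MonoidalCategory C]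

/-- Rotation by one click as a linear map. -/
def clickₗ [MonoidalPreadditive C] [MonoidalLinear ℂ C] (X : C) [ExactPairing X X] :
    (X ⊗ X ⟶ X ⊗ X) →ₗ[ℂ] (X ⊗ X ⟶ X ⊗ X) where
  toFun := click X
  map_add' f g := by simp only [click, MonoidalPreadditive.add_whiskerRight,
    MonoidalPreadditive.whiskerLeft_add, Preadditive.add_comp, Preadditive.comp_add]
  map_smul' c f := by simp only [click, MonoidalLinear.smul_whiskerRight,
    MonoidalLinear.whiskerLeft_smul, Linear.smul_comp, Linear.comp_smul, RingHom.id_apply]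

variable [MonoidalPreadditive C] [MonoidalLinear ℂ C] [BraidedCategory C] [BalancedCategory C]
  {X : C} [ExactPairing X X] {τ : X ⊗ X ⟶ X} {v α d b t : ℂ}

theorem IsTrivalentRibbon.rotation (hC : IsTrivalentRibbon X τ) (hv : v ≠ 0)
    (he : SatisfiesElementary X τ v d b t) :
    X ◁ τ ≫ ε_ X X = (α_ X X X).inv ≫ τ ▷ X ≫ ε_ X X := by
  obtain ⟨d', hd', hcirc⟩ := hC.circle_ne_zero
  refine vertex_rotation (c := -v ^ 6) (by simpa using hv) hC.box_zero.ne_zero hC.box_two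
    hC.box_three hd' hcirc ?_ he.twisted_vertex
  have : (-v ^ 6) ^ 2 = v ^ 12 := by ring
  rw [this]
  exact he.twisted_cup

omit [MonoidalLinear ℂ C] in
theorem IsTrivalentRibbon.vertex_ne (hC : IsTrivalentRibbon X τ) : τ ≠ 0 := by
  rintro rfl
  exact hC.box_three.ne_zero (by simp)

/-- The linear algebra of diagrams with four legs in a trivalent ribbon category. -/
def IsTrivalentRibbon.fourBox (hC : IsTrivalentRibbon X τ)
    (he : SatisfiesElementary X τ v d b t) (hJ : SatisfiesQEJac X τ v α)
    (hv10 : v ^ 10 ≠ 1) (hv12 : v ^ 12 ≠ 1) :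
    FourBox (X ⊗ X ⟶ X ⊗ X) (𝟙_ C ⟶ X ⊗ X) (X ⊗ X ⟶ X) v α d b t :=
  have hv := hJ.v_ne_zero
  have hc : -v ^ 6 ≠ 0 := by simpa using hv
  have hsq : (-v ^ 6) ^ 2 = v ^ 12 := by ring
  have rot := hC.rotation hv he
  have hcirc : η_ X X ≫ ε_ X X = d • 𝟙 (𝟙_ C) := he.circle
  have hd : d ≠ 0 := by
    obtain ⟨d', hd', hcirc'⟩ := hC.circle_ne_zero
    have := smul_left_injective ℂ hC.box_zero.ne_zero (he.circle.symm.trans hcirc')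
    exact this ▸ hd'
  have hbig : coprod X τ ≫ τ = b • 𝟙 X := by rw [← eval_split]; exact he.bigon
  have hX : 𝟙 X ≠ 0 := fun h => hC.vertex_ne (by rw [← Category.comp_id τ, h]; simp)
  have hb : b ≠ 0 := by
    obtain ⟨b', hb', hbig'⟩ := hC.bigon_ne_zero
    have := smul_left_injective ℂ hX (he.bigon.symm.trans hbig')
    exact this ▸ hb'
  have hη : η_ X X ≠ 0 := fun h => by
    rw [h, Limits.zero_comp] at hcirc
    exact (smul_ne_zero hd hC.box_zero.ne_zero) hcirc.symm
  have hlol : η_ X X ≫ τ = 0 := he.lollipop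
  have htri : rung X τ ≫ τ = t • τ := by rw [← eval_H]; exact he.triangle
  have hτ : (β_ X X).inv ≫ τ = (-v ^ 6) • τ := he.twisted_vertex
  have hτ' := hom_comp_eq_inv_smul hc hτ
  have hcup : η_ X X ≫ (β_ X X).inv = v ^ 12 • η_ X X := he.twisted_cup
  have hcup' : η_ X X ≫ (β_ X X).hom = (v ^ 12)⁻¹ • η_ X X := by
    rw [eq_inv_smul_iff₀ (pow_ne_zero 12 hv), ← Linear.smul_comp, ← hcup]; simp
  have hco : coprod X τ ≫ (β_ X X).inv = (-v ^ 6) • coprod X τ :=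
    coprod_braiding_inv hc rot (hsq ▸ hcup) hτ
  have hco' : coprod X τ ≫ (β_ X X).hom = (-v ^ 6)⁻¹ • coprod X τ := by
    rw [eq_inv_smul_iff₀ hc, ← Linear.smul_comp, ← hco]; simp
  have hcr : η_ X X ≫ rung X τ = b • η_ X X := by rw [cup_rung rot, hbig]; simp
  have hrc : rung X τ ≫ ε_ X X = b • ε_ X X := by rw [rung_cap rot, hbig]; simp
  have jac : v ^ (-3 : ℤ) • (rung X τ ≫ (β_ X X).inv) + v • (τ ≫ coprod X τ) +
      (-v⁻¹) • rung X τ +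
      α • ((β_ X X).inv + v ^ (4 : ℤ) • (ε_ X X ≫ η_ X X) + v ^ (-4 : ℤ) • 𝟙 (X ⊗ X)) = 0 := by
    rw [← eval_qeJac]; exact hJ.jacobi
  { one := 𝟙 (X ⊗ X)
    E := ε_ X X ≫ η_ X X
    I := τ ≫ coprod X τ
    H := rung X τ
    N := (β_ X X).inv
    P := (β_ X X).hom
    Q := rung X τ ≫ rung X τ
    rot := clickₗ X
    rungL := Linear.leftComp ℂ _ (rung X τ)
    crossR := Linear.rightComp ℂ _ (β_ X X).inv
    onCup := Linear.leftComp ℂ _ (η_ X X)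
    onVertex := Linear.rightComp ℂ _ τ
    cup := η_ X X
    vertex := τ
    cup_ne := hη
    vertex_ne := hC.vertex_ne
    rot_one := click_id
    rot_E := click_cap_cup
    rot_I := click_vertex_coprod rot
    rot_H := click_rung rot
    rot_N := click_braiding_inv
    rot_P := click_braiding
    rot_Q := click_square rot
    rungL_one := by simp
    rungL_E := by simp [reassoc_of% hrc]
    rungL_I := by simp [reassoc_of% htri]
    rungL_H := rfl
    -- The Jacobi relation, multiplied by v³ and solved for HN.
    rungL_N := by
      rw [Linear.leftComp_apply, ← sub_eq_zero]
      refine Eq.trans ?_ ((congrArg (v ^ 3 • ·) jac).trans (smul_zero _))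
      simp only [zpow_neg, zpow_ofNat]
      match_scalars <;> field_simp
    -- The Jacobi relation followed by the positive crossing and multiplied by -v.
    rungL_P := by
      have h := congrArg (· ≫ (β_ X X).hom) jac
      simp only [Preadditive.add_comp, Linear.smul_comp, Category.assoc, Iso.inv_hom_id,
        Category.comp_id, Category.id_comp, hcup', hco', Linear.comp_smul, Limits.zero_comp] at h
      rw [Linear.leftComp_apply, ← sub_eq_zero]
      refine Eq.trans ?_ ((congrArg ((-v) • ·) h).trans (smul_zero _))
      simp only [zpow_neg, zpow_ofNat]
      match_scalars <;> field_simp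
    crossR_one := by simp
    crossR_E := by simp [hcup]
    crossR_I := by simp [hco]
    crossR_H := rfl
    onCup_one := by simp
    onCup_E := by simp [reassoc_of% hcirc]
    onCup_I := by simp [reassoc_of% hlol]
    onCup_H := hcr
    onCup_N := hcup
    onCup_P := by simpa using hcup'
    onVertex_one := by simp
    onVertex_E := by simp [hlol]
    onVertex_I := by simp [hbig]
    onVertex_H := htri
    onVertex_N := hτ
    onVertex_P := by
      rw [Linear.rightComp_apply, hτ', inv_neg, inv_pow]
    v_ne := hv
    b_ne := hb
    d_ne := hd
    v10 := hv10
    v12 := hv12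
    jacobi_cup := by
      have h := congrArg (η_ X X ≫ ·) jac
      simp only [Preadditive.comp_add, Linear.comp_smul, reassoc_of% hcr, reassoc_of% hlol,
        reassoc_of% hcirc, hcr, hcup, Linear.smul_comp, Category.comp_id, Category.id_comp,
        Limits.zero_comp, Limits.comp_zero, smul_zero, add_zero, smul_smul, smul_add] at h
      have h' : v ^ (-3 : ℤ) * (b * v ^ 12) + -v⁻¹ * b +
          α * (v ^ 12 + v ^ (4 : ℤ) * d + v ^ (-4 : ℤ)) = 0 := by
        refine (smul_eq_zero_iff_left hη).1 (Eq.trans ?_ h)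
        module
      simp only [zpow_neg, zpow_ofNat] at h'
      rw [← sub_eq_zero]
      refine Eq.trans ?_ ((congrArg (v⁻¹ ^ 4 * ·) h').trans (mul_zero _))
      field_simp
      ring
    jacobi_vertex := by
      have h := congrArg (· ≫ τ) jac
      simp only [Preadditive.add_comp, Linear.smul_comp, Category.assoc, htri, hbig, hlol, hτ,
        Linear.comp_smul, Category.comp_id, Category.id_comp,
        Limits.zero_comp, Limits.comp_zero, smul_zero, add_zero, smul_smul, smul_add] at h
      have h' : v ^ (-3 : ℤ) * (-v ^ 6 * t) + v * b + -v⁻¹ * t +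
          α * (-v ^ 6 + v ^ (-4 : ℤ)) = 0 := by
        refine (smul_eq_zero_iff_left hC.vertex_ne).1 (Eq.trans ?_ h)
        module
      simp only [zpow_neg, zpow_ofNat] at h'
      rw [← sub_eq_zero]
      refine Eq.trans ?_ ((congrArg (-v⁻¹ * ·) h').trans (mul_zero _))
      field_simp
      ring }

end Construction

/-! ### The dimension bound. -/

theorem exists_relation_of_rank_le {C : Type u₁} [Category.{v₁} C] [Preadditive C] [Linear ℂ C]
    [MonoidalCategory C] [MonoidalPreadditive C] [MonoidalLinear ℂ C] {X : C} [ExactPairing X X]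
    (hdim : Module.rank ℂ (((X ⊗ X) ⊗ X) ⊗ X ⟶ 𝟙_ C) ≤ 5) (e : Fin 6 → (X ⊗ X ⟶ X ⊗ X)) :
    ∃ g : Fin 6 → ℂ, g ≠ 0 ∧ ∑ i, g i • e i = 0 := by
  let L : (X ⊗ X ⟶ X ⊗ X) →ₗ[ℂ] (((X ⊗ X) ⊗ X) ⊗ X ⟶ 𝟙_ C) :=
    { toFun f := (α_ (X ⊗ X) X X).hom ≫ f ▷ (X ⊗ X) ≫ ε_ (X ⊗ X) (X ⊗ X)
      map_add' f g := by simp only [MonoidalPreadditive.add_whiskerRight, Preadditive.add_comp,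
        Preadditive.comp_add]
      map_smul' c f := by simp only [MonoidalLinear.smul_whiskerRight, Linear.smul_comp,
        Linear.comp_smul, RingHom.id_apply] }
  have hL : Function.Injective L := fun f g h =>
    eq_of_whiskerRight_cap ((cancel_epi (α_ (X ⊗ X) X X).hom).1 h)
  have hr : Module.rank ℂ (X ⊗ X ⟶ X ⊗ X) ≤ 5 := (LinearMap.rank_le_of_injective L hL).trans hdim
  have hn : ¬ LinearIndependent ℂ e := fun h => by
    have h1 := h.cardinal_lift_le_rank
    have h2 := h1.trans (Cardinal.lift_le.2 hr)
    simp only [Cardinal.mk_fin, Cardinal.lift_natCast, Cardinal.lift_ofNat] at h2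
    exact absurd h2 (by norm_cast)
  rw [Fintype.linearIndependent_iff] at hn
  push Not at hn
  obtain ⟨g, hg, i, hi⟩ := hn
  exact ⟨g, fun h => hi (by rw [h]; rfl), hg⟩

/-! ### Identities between the constants of the quantum exceptional category. -/

section Parameters

variable {v w : ℂ}

theorem psi1_eq (hv : v ≠ 0) : psi1 v = (v ^ 2 - 1) / v := by
  rw [psi1]; field_simp

theorem psi2_eq (hv : v ≠ 0) : psi2 v = (v ^ 2 + 1) / v := by
  rw [psi2]; field_simp

theorem psi3_eq (hv : v ≠ 0) : psi3 v = (v ^ 4 + v ^ 2 + 1) / v ^ 2 := by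
  rw [psi3]; field_simp

theorem psi4_eq (hv : v ≠ 0) : psi4 v = (v ^ 4 + 1) / v ^ 2 := by
  rw [psi4]; field_simp

theorem psi6_eq (hv : v ≠ 0) : psi6 v = (v ^ 4 - v ^ 2 + 1) / v ^ 2 := by
  rw [psi6]; field_simp

theorem lamProd_eq (hv : v ≠ 0) (hw : w ≠ 0) :
    lamProd v w = (w ^ 2 - 1) * (w ^ 2 - v ^ 2) / (w ^ 2 * v) := by
  simp only [lamProd, qsub, zpow_neg, zpow_one, zpow_zero]; field_simp

/-- The formula defining `FourBox.crossCoeff`, solved for b at B = Ψ₆/Ψ₁ and α = -[λ][λ-1]/Ψ₁. In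
the same way `triangleVal_eq` and `circleVal_eq` are `jacobi_vertex` and `jacobi_cup` at these
values. -/
theorem bigonVal_eq (hv : v ≠ 0) (hw : w ≠ 0) :
    bigonVal v w = psi3 v * (lamProd v w + psi2 v * psi4 v * psi6 v) := by
  rw [lamProd_eq hv hw, psi2_eq hv, psi4_eq hv, psi6_eq hv]
  simp only [bigonVal, qadd, zpow_neg, zpow_ofNat]; field_simp; ring

theorem triangleVal_eq (hv : v ≠ 0) (hw : w ≠ 0) (h1 : psi1 v ≠ 0) :
    triangleVal v w * (v ^ 2 + v⁻¹ ^ 2) =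
      bigonVal v w + lamProd v w / psi1 v * (v ^ 5 - v⁻¹ ^ 5) := by
  rw [psi1_eq hv] at h1 ⊢
  have h1' : v ^ 2 - 1 ≠ 0 := fun h => h1 (by rw [h, zero_div])
  rw [bigonVal_eq hv hw, lamProd_eq hv hw, psi2_eq hv, psi3_eq hv, psi4_eq hv, psi6_eq hv,
    triangleVal, psi2_eq hv]
  simp only [qadd, zpow_neg, zpow_ofNat]; field_simp; ring

theorem circleVal_eq (hv : v ≠ 0) (hw : w ≠ 0) (h1 : psi1 v ≠ 0) (hL : lamProd v w ≠ 0) :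
    bigonVal v w * (v ^ 5 - v⁻¹ ^ 5) =
      lamProd v w / psi1 v * (v ^ 8 + circleVal v w + v⁻¹ ^ 8) := by
  have hc : circleVal v w * lamProd v w =
      -(psi4 v * (lamProd v w + v + v⁻¹ - v ^ 11 - v⁻¹ ^ 11)) := by
    rw [circleVal, ← lamProd, neg_mul, div_mul_cancel₀ _ hL, lamProd_eq hv hw, mul_assoc]
    congr 2
    simp only [qsub, zpow_neg, zpow_ofNat]; field_simp; ring
  rw [div_mul_eq_mul_div, eq_div_iff h1, mul_add, mul_add, mul_comm (lamProd v w) (circleVal v w),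
    hc, bigonVal_eq hv hw, psi1_eq hv, psi2_eq hv, psi3_eq hv, psi4_eq hv, psi6_eq hv]
  field_simp; ring

/-- This and the next three identities put the square coefficients in the form that
`FourBox.square_eq` produces once P is eliminated. -/
theorem sqI_eq (hv : v ≠ 0) (hw : w ≠ 0) (h1 : psi1 v ≠ 0) :
    sqI v w / psi1 v = psi6 v / psi1 v * (v ^ 4 - v⁻¹ ^ 4) - lamProd v w / psi1 v * v⁻¹ ^ 3 -
      triangleVal v w := by
  rw [psi1_eq hv] at h1 ⊢
  have h1' : v ^ 2 - 1 ≠ 0 := fun h => h1 (by rw [h, zero_div])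
  rw [lamProd_eq hv hw, psi6_eq hv, triangleVal, psi2_eq hv]
  simp only [sqI, qadd, zpow_neg, zpow_ofNat]; field_simp; ring

theorem sqH_eq (hv : v ≠ 0) (hw : w ≠ 0) (h1 : psi1 v ≠ 0) :
    sqH v w / psi1 v = psi6 v / psi1 v * (v⁻¹ ^ 2 - v ^ 2) + lamProd v w / psi1 v * v⁻¹ ^ 3 -
      lamProd v w := by
  rw [psi1_eq hv] at h1 ⊢
  have h1' : v ^ 2 - 1 ≠ 0 := fun h => h1 (by rw [h, zero_div])
  rw [lamProd_eq hv hw, psi6_eq hv]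
  simp only [sqH, zpow_neg, zpow_ofNat]; field_simp; ring

theorem sqCapCup_eq (hv : v ≠ 0) (hw : w ≠ 0) (h1 : psi1 v ≠ 0) :
    sqCapCup v w / psi1 v ^ 2 = -(psi6 v / psi1 v * (lamProd v w / psi1 v) * (v ^ 7 + v⁻¹ ^ 7)) +
      lamProd v w / psi1 v * v⁻¹ ^ 3 * lamProd v w + lamProd v w * bigonVal v w := by
  rw [bigonVal_eq hv hw]
  rw [psi1_eq hv] at h1 ⊢
  have h1' : v ^ 2 - 1 ≠ 0 := fun h => h1 (by rw [h, zero_div])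
  rw [lamProd_eq hv hw, psi2_eq hv, psi3_eq hv, psi4_eq hv, psi6_eq hv]
  simp only [sqCapCup, zpow_neg, zpow_ofNat]; field_simp; ring

theorem sqTwoStrands_eq (hv : v ≠ 0) (hw : w ≠ 0) (h1 : psi1 v ≠ 0) :
    sqTwoStrands v w / psi1 v ^ 2 = -(psi6 v / psi1 v * (lamProd v w / psi1 v) * (v + v⁻¹)) -
      lamProd v w / psi1 v * v⁻¹ ^ 3 * lamProd v w := by
  rw [psi1_eq hv] at h1 ⊢
  have h1' : v ^ 2 - 1 ≠ 0 := fun h => h1 (by rw [h, zero_div])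
  rw [lamProd_eq hv hw, psi6_eq hv]
  simp only [sqTwoStrands, zpow_neg, zpow_ofNat]; field_simp; ring

/-- With x = w² this is x² - (v² + 1 + Lv)x + v² = 0; the constant term v² keeps the roots away from
0. -/
theorem exists_lamProd_eq (hv : v ≠ 0) (L : ℂ) : ∃ w : ℂ, w ≠ 0 ∧ lamProd v w = L := by
  -- `s` is a square root of the discriminant.
  obtain ⟨s, hs⟩ := IsAlgClosed.exists_pow_nat_eq
    ((v ^ 2 + 1 + L * v) ^ 2 - 4 * v ^ 2) (n := 2) two_pos
  obtain ⟨w, hw⟩ := IsAlgClosed.exists_pow_nat_eq ((v ^ 2 + 1 + L * v + s) / 2) (n := 2) two_pos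
  have h : (w ^ 2 - 1) * (w ^ 2 - v ^ 2) = L * (w ^ 2 * v) := by
    rw [hw]; linear_combination hs / 4
  have hw0 : w ≠ 0 := by
    rintro rfl
    apply pow_ne_zero 2 hv
    linear_combination h
  refine ⟨w, hw0, ?_⟩
  rw [lamProd_eq hv hw0, h, mul_div_cancel_right₀]
  exact mul_ne_zero (pow_ne_zero 2 hw0) hv

end Parameters

/-! ### From skein relations to the evaluation functor. -/

section Soundness

variable {C : Type u₁} [Category.{v₁} C] [Preadditive C] [Linear ℂ C] [MonoidalCategory C]
  [MonoidalPreadditive C] [MonoidalLinear ℂ C] [BraidedCategory C] [BalancedCategory C]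
  {X : C} [ExactPairing X X] {τ : X ⊗ X ⟶ X} {v w : ℂ}

open BraidedCategory in
-- Apart from the three hypotheses (skein relations, curl, rotation), every constructor of `Rel` is
-- a law of linear balanced categories or a zigzag of the chosen duality.
theorem eval_eq_of_rel
    (hskein : ∀ {A B : Pts} {f g : Diag A B}, Skein v w f g → f.eval X τ = g.eval X τ)
    (hcurl : η_ X X ≫ (BalancedCategory.twist X).hom ▷ X = η_ X X ≫ (β_ X X).inv)
    (rot : X ◁ τ ≫ ε_ X X = (α_ X X X).inv ≫ τ ▷ X ≫ ε_ X X)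
    {A B : Pts} {f g : Diag A B} (h : Rel v w f g) : f.eval X τ = g.eval X τ := by
  induction h with
  | refl => rfl
  | symm _ ih => exact ih.symm
  | trans _ _ ih ih' => exact ih.trans ih'
  | comp_congr _ _ ih ih' => simp only [Diag.eval, ih, ih']
  | tensor_congr _ _ ih ih' => exact congrArg₂ (· ⊗ₘ ·) ih ih'
  | add_congr _ _ ih ih' => simp only [eval_add, ih, ih']
  | smul_congr _ _ ih => simp only [eval_smul, ih]
  | add_assoc => exact add_assoc _ _ _
  | add_comm => exact add_comm _ _
  | zero_add => exact zero_add _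
  | zero_smul => exact zero_smul _ _
  | one_smul => exact one_smul _ _
  | mul_smul => exact mul_smul _ _ _
  | smul_add => exact smul_add _ _ _
  | add_smul => exact add_smul _ _ _
  | add_comp => exact Preadditive.add_comp _ _ _ _ _ _
  | comp_add => exact Preadditive.comp_add _ _ _ _ _ _
  | smul_comp => exact Linear.smul_comp _ _ _ _ _ _
  | comp_smul => exact Linear.comp_smul _ _ _ _ _ _
  | add_tensor => simp only [Diag.eval, MonoidalPreadditive.add_tensor]; rfl
  | tensor_add => simp only [Diag.eval, MonoidalPreadditive.tensor_add]; rfl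
  | smul_tensor =>
    simp only [Diag.eval, eval_smul, MonoidalCategory.tensorHom_def,
      MonoidalLinear.smul_whiskerRight, Linear.smul_comp]
    rfl
  | tensor_smul =>
    simp only [Diag.eval, eval_smul, MonoidalCategory.tensorHom_def,
      MonoidalLinear.whiskerLeft_smul, Linear.comp_smul]
    rfl
  | id_comp => exact Category.id_comp _
  | comp_id => exact Category.comp_id _
  | comp_assoc => exact Category.assoc _ _ _
  | tensor_id => exact id_tensorHom_id _ _
  | tensor_comp => exact tensorHom_comp_tensorHom _ _ _ _
  | assoc_hom_inv => exact Iso.hom_inv_id _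
  | assoc_inv_hom => exact Iso.inv_hom_id _
  | assoc_naturality => exact associator_naturality _ _ _
  | lunit_hom_inv => exact Iso.hom_inv_id _
  | lunit_inv_hom => exact Iso.inv_hom_id _
  | lunit_naturality => simp [Diag.eval, Pts.eval]
  | runit_hom_inv => exact Iso.hom_inv_id _
  | runit_inv_hom => exact Iso.inv_hom_id _
  | runit_naturality => simp [Diag.eval, Pts.eval]
  | pentagon => simp [Diag.eval, Pts.eval]
  | triangle => simp [Diag.eval, Pts.eval]
  | braid_hom_inv => exact Iso.hom_inv_id _
  | braid_inv_hom => exact Iso.inv_hom_id _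
  | braid_naturality => exact braiding_naturality _ _
  | hexagon_forward => simp [Diag.eval, Pts.eval]
  | hexagon_reverse => simp [Diag.eval, Pts.eval]
  | twist_hom_inv => exact Iso.hom_inv_id _
  | twist_inv_hom => exact Iso.inv_hom_id _
  | twist_naturality => exact BalancedCategory.twist_naturality _
  | twist_tensor => exact BalancedCategory.twist_tensor _ _
  | twist_curl =>
    simpa [Diag.eval, Pts.eval, Diag.twistedCup, Diag.negX] using hcurl
  | zigzag_left =>
    simp [Diag.eval, Pts.eval]
  | zigzag_right =>
    simp [Diag.eval, Pts.eval]
  | rotate =>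
    change (ρ_ (X ⊗ X)).inv ≫ (𝟙 (X ⊗ X) ⊗ₘ η_ X X) ≫ (α_ X X (X ⊗ X)).hom ≫
      (𝟙 X ⊗ₘ (α_ X X X).inv) ≫ (𝟙 X ⊗ₘ (τ ⊗ₘ 𝟙 X)) ≫ (α_ X X X).inv ≫ (ε_ X X ⊗ₘ 𝟙 X) ≫
      (λ_ X).hom = τ
    refine Eq.trans ?_ (rotated_vertex rot)
    simp only [id_tensorHom, tensorHom_id]
    monoidal
  | skein h => exact hskein h

/-- The functor given by an evaluation of diagrams that satisfies the skein relations. -/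
def evalFunctor
    (hrel : ∀ {A B : Pts} {f g : Diag A B}, Rel v w f g → f.eval X τ = g.eval X τ) :
    QExc v w ⥤ C where
  obj A := A.pts.eval X
  map f := Quotient.lift (Diag.eval X τ) (fun _ _ h => hrel h) f
  map_id _ := rfl
  map_comp := by rintro _ _ _ ⟨f⟩ ⟨g⟩; rfl

/-- The tensor structure of `evalFunctor`. -/
def evalFunctorCore
    (hrel : ∀ {A B : Pts} {f g : Diag A B}, Rel v w f g → f.eval X τ = g.eval X τ) :
    (evalFunctor (v := v) (w := w) (X := X) (τ := τ) hrel).CoreMonoidal where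
  εIso := Iso.refl _
  μIso _ _ := Iso.refl _
  μIso_hom_natural_left := by
    rintro A B ⟨f⟩ D
    change f.eval X τ ▷ D.pts.eval X ≫ 𝟙 _ = 𝟙 _ ≫ (f.eval X τ ⊗ₘ 𝟙 (D.pts.eval X))
    simp
  μIso_hom_natural_right := by
    rintro A B D ⟨f⟩
    change D.pts.eval X ◁ f.eval X τ ≫ 𝟙 _ = 𝟙 _ ≫ (𝟙 (D.pts.eval X) ⊗ₘ f.eval X τ)
    simp
  associativity A B D := by
    change 𝟙 (A.pts.eval X ⊗ B.pts.eval X) ▷ D.pts.eval X ≫ 𝟙 _ ≫ (α_ _ _ _).hom =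
      (α_ (A.pts.eval X) (B.pts.eval X) (D.pts.eval X)).hom ≫ _ ◁ 𝟙 _ ≫ 𝟙 _
    simp
  left_unitality A := by
    change (λ_ (A.pts.eval X)).hom = 𝟙 _ ▷ _ ≫ 𝟙 _ ≫ (λ_ (A.pts.eval X)).hom
    simp
  right_unitality A := by
    change (ρ_ (A.pts.eval X)).hom = _ ◁ 𝟙 _ ≫ 𝟙 _ ≫ (ρ_ (A.pts.eval X)).hom
    simp

/-- The evaluation functor obtained from an evaluation of diagrams that satisfies the skein
relations. -/
def EvaluationFunctor.ofRel
    (hrel : ∀ {A B : Pts} {f g : Diag A B}, Rel v w f g → f.eval X τ = g.eval X τ) :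
    EvaluationFunctor v w X τ :=
  letI := (evalFunctorCore (v := v) (w := w) (X := X) (τ := τ) hrel).toMonoidal
  { functor := evalFunctor hrel
    additive := ⟨by rintro _ _ ⟨f⟩ ⟨g⟩; rfl⟩
    linear := ⟨by rintro _ _ ⟨f⟩ r; rfl⟩
    braided := ⟨fun A B => by
      change 𝟙 _ ≫ (β_ (A.pts.eval X) (B.pts.eval X)).hom =
        (β_ (A.pts.eval X) (B.pts.eval X)).hom ≫ 𝟙 _
      simp⟩
    map_twist _ := rfl
    strandIso := Iso.refl _
    map_vertex := by
      change 𝟙 (X ⊗ X) ≫ τ ≫ 𝟙 X = (𝟙 X ⊗ₘ 𝟙 X) ≫ τ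
      simp }

end Soundness

/-! ### The skein relations after rescaling by k. -/

section Eval

variable {C : Type u₁} [Category.{v₁} C] [Preadditive C] [Linear ℂ C] [MonoidalCategory C]
  [BraidedCategory C] [BalancedCategory C] (X : C) [ExactPairing X X] (τ : X ⊗ X ⟶ X)

theorem eval_qeSq (v w : ℂ) : @Eq (X ⊗ X ⟶ X ⊗ X) ((qeSq v w).eval X τ)
    (rung X τ ≫ rung X τ + (-psi2 v * psi6 v ^ 2 * lamProd v w / psi1 v ^ 2) • (β_ X X).inv +
      (sqI v w / psi1 v) • (τ ≫ coprod X τ) + (sqH v w / psi1 v) • rung X τ +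
      (sqCapCup v w / psi1 v ^ 2) • (ε_ X X ≫ η_ X X) +
      (sqTwoStrands v w / psi1 v ^ 2) • 𝟙 (X ⊗ X)) := by
  rw [← eval_I, ← eval_H]; rfl

theorem eval_qeCross (v w : ℂ) : @Eq (X ⊗ X ⟶ X ⊗ X) ((qeCross v w).eval X τ)
    ((β_ X X).inv + (-1 : ℂ) • (β_ X X).hom +
      (psi1 v / psi6 v) • (τ ≫ coprod X τ + (-1 : ℂ) • rung X τ) +
      (psi1 v * lamProd v w / psi6 v) • (𝟙 (X ⊗ X) + (-1 : ℂ) • (ε_ X X ≫ η_ X X))) := by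
  rw [← eval_I, ← eval_H]; rfl

end Eval

namespace FourBox

variable {V M₁ M₂ : Type*} [AddCommGroup V] [Module ℂ V] [AddCommGroup M₁] [Module ℂ M₁]
    [AddCommGroup M₂] [Module ℂ M₂] {v w α d b t k : ℂ} (S : FourBox V M₁ M₂ v α d b t)

include S

theorem bigon_scaled (hw : w ≠ 0) (hu : k * crossCoeff v α b = psi6 v / psi1 v)
    (hα : k * α = -(lamProd v w / psi1 v)) : k * b = bigonVal v w := by
  have := S.crossCoeff_mul
  rw [bigonVal_eq S.v_ne hw]
  have e1 : k * crossCoeff v α b * psi1 v = psi6 v := by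
    rw [hu, div_mul_cancel₀ _ S.psi1_ne]
  have e2 : k * α * psi1 v = -lamProd v w := by
    rw [hα, neg_mul, div_mul_cancel₀ _ S.psi1_ne]
  linear_combination (-k) * this + psi2 v * psi3 v * psi4 v * e1 - psi3 v * e2

theorem triangle_scaled (hw : w ≠ 0) (hu : k * crossCoeff v α b = psi6 v / psi1 v)
    (hα : k * α = -(lamProd v w / psi1 v)) : k * t = triangleVal v w := by
  have h4 : v ^ 2 + v⁻¹ ^ 2 ≠ 0 := by
    have := S.psi4_ne
    rwa [psi4, zpow_neg, zpow_ofNat, ← inv_pow] at this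
  apply mul_right_cancel₀ h4
  rw [triangleVal_eq S.v_ne hw S.psi1_ne, ← S.bigon_scaled hw hu hα]
  linear_combination k * S.jacobi_vertex - (v ^ 5 - v⁻¹ ^ 5) * hα

theorem lamProd_ne (hk : k ≠ 0) (hα : k * α = -(lamProd v w / psi1 v)) : lamProd v w ≠ 0 := by
  intro h0
  rw [h0, zero_div, neg_zero] at hα
  exact mul_ne_zero hk S.alpha_ne hα

/-- No factor k multiplies d: the circle has one cup and one cap, and their factors cancel. -/
theorem circle_scaled (hk : k ≠ 0) (hw : w ≠ 0) (hu : k * crossCoeff v α b = psi6 v / psi1 v)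
    (hα : k * α = -(lamProd v w / psi1 v)) : d = circleVal v w := by
  have hL := S.lamProd_ne hk hα
  have := circleVal_eq S.v_ne hw S.psi1_ne hL
  apply mul_left_cancel₀ (div_ne_zero hL S.psi1_ne)
  rw [← S.bigon_scaled hw hu hα] at this
  linear_combination (-k) * S.jacobi_cup + this + (v ^ 8 + d + v⁻¹ ^ 8) * hα

theorem jacobi_scaled (k : ℂ) : v ^ (-3 : ℤ) • (k • S.rungL S.N) + v • (k • S.I) +
    (-v⁻¹) • (k • S.H) +
    (k * α) • (S.N + v ^ (4 : ℤ) • S.E + v ^ (-4 : ℤ) • S.one) = 0 := by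
  have := S.v_ne
  rw [S.rungL_N]
  simp only [zpow_neg, zpow_ofNat]
  match_scalars <;> field_simp <;> ring

theorem crossing_scaled (hZ : S.anti (-(α * psi1 v)) 1 (crossCoeff v α b) = 0)
    (hu : k * crossCoeff v α b = psi6 v / psi1 v) (hα : k * α = -(lamProd v w / psi1 v)) :
    S.N + (-1 : ℂ) • S.P + (psi1 v / psi6 v) • (k • S.I + (-1 : ℂ) • (k • S.H)) +
      (psi1 v * lamProd v w / psi6 v) • (S.one + (-1 : ℂ) • S.E) = 0 := by
  have h1 := S.psi1_ne
  have h6 := S.psi6_ne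
  have e1 : psi1 v / psi6 v * k * crossCoeff v α b = 1 := by rw [mul_assoc, hu]; field_simp
  have e2 : psi1 v / psi6 v * k * -(α * psi1 v) = psi1 v * lamProd v w / psi6 v := by
    rw [mul_assoc, show k * -(α * psi1 v) = -(k * α) * psi1 v by ring, hα]; field_simp
  have h := congrArg ((psi1 v / psi6 v * k) • ·) hZ
  simp only [anti, smul_add, smul_zero, smul_smul, e1] at h
  simp only [← smul_smul _ (-(α * psi1 v))] at h
  rw [smul_smul, e2] at h
  rw [← h]
  module

theorem square_scaled (hZ : S.anti (-(α * psi1 v)) 1 (crossCoeff v α b) = 0) (hw : w ≠ 0)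
    (hu : k * crossCoeff v α b = psi6 v / psi1 v) (hα : k * α = -(lamProd v w / psi1 v)) :
    k • k • S.Q + (-psi2 v * psi6 v ^ 2 * lamProd v w / psi1 v ^ 2) • S.N +
      (sqI v w / psi1 v) • (k • S.I) + (sqH v w / psi1 v) • (k • S.H) +
      (sqCapCup v w / psi1 v ^ 2) • S.E + (sqTwoStrands v w / psi1 v ^ 2) • S.one = 0 := by
  have hv := S.v_ne
  have h1 := S.psi1_ne
  have h6 := S.psi6_ne
  -- The square relation to be proved contains N but not P, so P is eliminated by the crossing
  -- relation.
  have hP : S.P = S.N + (psi1 v / psi6 v) • (k • S.I - k • S.H) +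
      (psi1 v * lamProd v w / psi6 v) • (S.one - S.E) := by
    rw [← sub_eq_zero, ← neg_eq_zero, ← S.crossing_scaled hZ hu hα]
    module
  have hN : k • S.rungL S.N = (-v ^ 4) • (k • S.I) + v ^ 2 • (k • S.H) - (k * α * v ^ 3) • S.N -
      (k * α * v ^ 7) • S.E - (k * α * v⁻¹) • S.one := by
    rw [S.rungL_N]; module
  have hNP : k • S.rungL S.P = v⁻¹ ^ 2 • (k • S.H) - v⁻¹ ^ 4 • (k • S.I) +
      (k * α * v⁻¹ ^ 3) • S.P + (k * α * v) • S.one + (k * α * v⁻¹ ^ 7) • S.E := by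
    rw [S.rungL_P]; module
  have hQ : k • k • S.Q = (k * crossCoeff v α b) • (k • S.rungL S.N - k • S.rungL S.P) -
      (k * α * psi1 v) • (k • S.H - (k * b) • S.E) + (k * t) • (k • S.I) := by
    rw [S.square_eq hZ]; module
  rw [hQ, hN, hNP, hP, S.triangle_scaled hw hu hα, S.bigon_scaled hw hu hα, hu, hα,
    sqI_eq hv hw h1, sqH_eq hv hw h1, sqCapCup_eq hv hw h1, sqTwoStrands_eq hv hw h1]
  -- The one identity still needed between Ψ's; after it Ψ₁ and Ψ₆ can be treated as independent
  -- variables.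
  have e36 : psi2 v * psi6 v = v ^ 3 + v⁻¹ ^ 3 := by
    simp only [psi2, psi6]; field_simp; ring
  rw [show -psi2 v * psi6 v ^ 2 = -(v ^ 3 + v⁻¹ ^ 3) * psi6 v by rw [← e36]; ring]
  generalize k • S.I = I'
  generalize k • S.H = H'
  generalize psi1 v = p1 at *
  generalize psi6 v = p6 at *
  match_scalars <;> field_simp <;> ring

end FourBox

/-! ### Rescaling the self-duality. -/

section Scaling

variable {C : Type u₁} [Category.{v₁} C] [Preadditive C] [Linear ℂ C] [MonoidalCategory C]
  [MonoidalPreadditive C] [MonoidalLinear ℂ C] {X : C} [ExactPairing X X]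

/-- The self-duality with the cup multiplied by `k` and the cap divided by `k`. -/
@[reducible]
noncomputable def scaledPairing (X : C) [ExactPairing X X] {k : ℂ} (hk : k ≠ 0) : ExactPairing X X where
  coevaluation' := k • η_ X X
  evaluation' := k⁻¹ • ε_ X X
  coevaluation_evaluation' := by
    simp [smul_smul, hk]
  evaluation_coevaluation' := by
    simp [smul_smul, hk]

theorem coprod_scaled {k : ℂ} (hk : k ≠ 0) (τ : X ⊗ X ⟶ X) :
    @coprod C _ _ X (scaledPairing X hk) τ = k • coprod X τ := by
  change (λ_ X).inv ≫ (k • η_ X X) ▷ X ≫ (α_ X X X).hom ≫ X ◁ τ = _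
  simp [coprod]

theorem rung_scaled {k : ℂ} (hk : k ≠ 0) (τ : X ⊗ X ⟶ X) :
    @rung C _ _ X (scaledPairing X hk) τ = k • rung X τ := by
  rw [rung, coprod_scaled hk]
  simp [rung]

omit [MonoidalPreadditive C] [MonoidalLinear ℂ C] in
theorem cap_cup_scaled {k : ℂ} (hk : k ≠ 0) : (k⁻¹ • ε_ X X) ≫ (k • η_ X X) = ε_ X X ≫ η_ X X := by
  simp [smul_smul, hk]

variable [BraidedCategory C] [BalancedCategory C] {τ : X ⊗ X ⟶ X} {v w α d b t : ℂ}

/-- The skein relations hold for a suitably scaled self-duality. -/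
theorem eval_scaled_eq_of_skein (hC : IsTrivalentRibbon X τ)
    (he : SatisfiesElementary X τ v d b t) (hJ : SatisfiesQEJac X τ v α)
    (hv10 : v ^ 10 ≠ 1) (hv12 : v ^ 12 ≠ 1)
    (hZ : (hC.fourBox he hJ hv10 hv12).anti (-(α * psi1 v)) 1 (FourBox.crossCoeff v α b) = 0)
    {k : ℂ} (hk : k ≠ 0) (hw : w ≠ 0)
    (hu : k * FourBox.crossCoeff v α b = psi6 v / psi1 v)
    (hα : k * α = -(lamProd v w / psi1 v))
    {A B : Pts} {f g : Diag A B} (h : Skein v w f g) :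
    @Diag.eval C _ _ _ _ _ _ X (scaledPairing X hk) τ _ _ f =
      @Diag.eval C _ _ _ _ _ _ X (scaledPairing X hk) τ _ _ g := by
  let S := hC.fourBox he hJ hv10 hv12
  have hb : k * b = bigonVal v w := S.bigon_scaled hw hu hα
  have ht : k * t = triangleVal v w := S.triangle_scaled hw hu hα
  have hd : d = circleVal v w := S.circle_scaled hk hw hu hα
  have hcc : @coprod C _ _ X (scaledPairing X hk) τ = k • coprod X τ := coprod_scaled hk τ
  have hrr : @rung C _ _ X (scaledPairing X hk) τ = k • rung X τ := rung_scaled hk τ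
  have hI : τ ≫ (k • coprod X τ) = k • S.I := Linear.comp_smul _ _ _ _ _ _
  have hN : (k • rung X τ) ≫ (β_ X X).inv = k • S.rungL S.N := Linear.smul_comp _ _ _ _ _ _
  have hQ : (k • rung X τ) ≫ (k • rung X τ) = k • k • S.Q := by
    rw [Linear.smul_comp, Linear.comp_smul]; rfl
  have hec : (k⁻¹ • ε_ X X) ≫ (k • η_ X X) = S.E := cap_cup_scaled hk
  cases h with
  | circle =>
    change (k • η_ X X) ≫ (k⁻¹ • ε_ X X) = circleVal v w • 𝟙 (𝟙_ C)
    have hcirc : η_ X X ≫ ε_ X X = d • 𝟙 (𝟙_ C) := he.circle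
    simp [hcirc, hd, smul_smul, hk]
  | lollipop =>
    change (k • η_ X X) ≫ τ = 0
    have hlol : η_ X X ≫ τ = 0 := he.lollipop
    simp [hlol]
  | bigon =>
    have e := (@eval_split C _ _ _ _ _ _ X (scaledPairing X hk) τ).trans hcc
    have hbig : coprod X τ ≫ τ = b • 𝟙 X := by rw [← eval_split]; exact he.bigon
    refine (congrArg (fun f : X ⟶ X ⊗ X => f ≫ τ) e).trans ?_
    change (k • coprod X τ) ≫ τ = bigonVal v w • 𝟙 X
    rw [Linear.smul_comp, hbig, smul_smul, hb]
  | triangle =>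
    have e := (@eval_H C _ _ _ _ _ _ X (scaledPairing X hk) τ).trans hrr
    have htri : rung X τ ≫ τ = t • τ := by rw [← eval_H]; exact he.triangle
    refine (congrArg (fun f : X ⊗ X ⟶ X ⊗ X => f ≫ τ) e).trans ?_
    change (k • rung X τ) ≫ τ = triangleVal v w • τ
    rw [Linear.smul_comp, htri, smul_smul, ht]
  | twisted_vertex => exact he.twisted_vertex
  | twisted_cup =>
    change (k • η_ X X) ≫ (β_ X X).inv = v ^ 12 • k • η_ X X
    have hcup : η_ X X ≫ (β_ X X).inv = v ^ 12 • η_ X X := he.twisted_cup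
    rw [Linear.smul_comp, hcup, smul_comm]
  | jacobi =>
    refine (@eval_qeJac C _ _ _ _ _ _ X (scaledPairing X hk) τ v _).trans ?_
    rw [hcc, hrr, ← hα]
    refine Eq.trans ?_ (S.jacobi_scaled k)
    rw [hI, hN, ← hec]
    rfl
  | square =>
    refine (@eval_qeSq C _ _ _ _ _ _ X (scaledPairing X hk) τ v w).trans ?_
    rw [hcc, hrr]
    refine Eq.trans ?_ (S.square_scaled hZ hw hu hα)
    rw [hI, hQ, ← hec]
    rfl
  | crossing =>
    refine (@eval_qeCross C _ _ _ _ _ _ X (scaledPairing X hk) τ v w).trans ?_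
    rw [hcc, hrr]
    refine Eq.trans ?_ (S.crossing_scaled hZ hu hα)
    rw [hI, ← hec]
    rfl

end Scaling

end TriDiag

/-! ### Choice of k and w, and assembly. -/

theorem corollary1p11 {C : Type u₁} [Category.{v₁} C] [Preadditive C] [Linear ℂ C]
    [MonoidalCategory C] [MonoidalPreadditive C] [MonoidalLinear ℂ C] [BraidedCategory C]
    [RightRigidCategory C] [RibbonCategory C]
    (X : C) [ExactPairing X X] (τ : X ⊗ X ⟶ X)
    (hC : TriDiag.IsTrivalentRibbon X τ)
    (hdim : Module.rank ℂ (((X ⊗ X) ⊗ X) ⊗ X ⟶ 𝟙_ C) ≤ 5)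
    (v α : ℂ) (hJac : TriDiag.SatisfiesQEJac X τ v α)
    (hv10 : v ^ 10 ≠ 1) (hv12 : v ^ 12 ≠ 1) :
    ∃ w : ℂ, TriDiag.Admissible v w ∧
      Nonempty (TriDiag.EvaluationFunctor v w X τ) := by
  obtain ⟨d, b, t, he⟩ := hJac.elementary
  let S := hC.fourBox he hJac hv10 hv12
  have hv := hJac.v_ne_zero
  obtain ⟨g, hg, hrel⟩ := TriDiag.exists_relation_of_rank_le hdim ![S.one, S.E, S.I, S.H, S.N, S.P]
  have hZ := S.crossing hg hrel
  have hu := S.crossCoeff_ne hZ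
  have h1 : TriDiag.psi1 v ≠ 0 := S.psi1_ne
  have h6 : TriDiag.psi6 v ≠ 0 := S.psi6_ne
  obtain ⟨k, hk, hku⟩ : ∃ k : ℂ, k ≠ 0 ∧
      k * TriDiag.FourBox.crossCoeff v α b = TriDiag.psi6 v / TriDiag.psi1 v :=
    ⟨_, div_ne_zero (div_ne_zero h6 h1) hu, div_mul_cancel₀ _ hu⟩
  -- The value of [λ][λ-1] that makes the rescaled α equal to the coefficient in the Jacobi relation
  -- of the target parameters.
  obtain ⟨w, hw, hL⟩ := TriDiag.exists_lamProd_eq hv (-(k * α * TriDiag.psi1 v))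
  have hα : k * α = -(TriDiag.lamProd v w / TriDiag.psi1 v) := by rw [hL]; field_simp
  have hL0 : TriDiag.lamProd v w ≠ 0 := S.lamProd_ne hk hα
  refine ⟨w, ⟨hv, hw, left_ne_zero_of_mul hL0, right_ne_zero_of_mul hL0, h1, h6⟩, ?_⟩
  have hrot := hC.rotation hv he
  have hcup : η_ X X ≫ (β_ X X).inv = v ^ 12 • η_ X X := he.twisted_cup
  have hcurl : (k • η_ X X) ≫ (BalancedCategory.twist X).hom ▷ X =
      (k • η_ X X) ≫ (β_ X X).inv := by
    rw [TriDiag.twist_eq (c := -v ^ 6) (by simpa using hv) hC.box_two hC.vertex_ne he.twisted_vertex,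
      Linear.smul_comp, Linear.smul_comp, hcup, show (-v ^ 6) ^ 2 = v ^ 12 by ring]
    simp
  have hrot' : X ◁ τ ≫ (k⁻¹ • ε_ X X) = (α_ X X X).inv ≫ τ ▷ X ≫ (k⁻¹ • ε_ X X) := by
    simp only [Linear.comp_smul, hrot]
  have hskein := fun {A B : TriDiag.Pts} {f g : TriDiag.Diag A B} (h : TriDiag.Skein v w f g) =>
    TriDiag.eval_scaled_eq_of_skein hC he hJac hv10 hv12 hZ hk hw hku hα h
  -- From here instance resolution picks the rescaled duality, so the functor sends the generating
  -- cup to k times the given one, while the vertex still goes to `τ`.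
  let p : ExactPairing X X := TriDiag.scaledPairing X hk
  exact ⟨TriDiag.EvaluationFunctor.ofRel (X := X) (τ := τ) fun h =>
    TriDiag.eval_eq_of_rel (X := X) (τ := τ) hskein hcurl hrot' h⟩
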